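/- A probabilistic automaton is a tuple $\mathcal A=(Q,A,(M_a)_{a\in A},q_0,F)$ with a finite set $Q$ of states, a finite alphabet $A$, for each letter $a\in A$ a $Q\times Q$ matrix $M_a$ with rational entries in $[0,1]$ and rows summing to $1$ ($M_a(s,t)$ is the probability of going from $s$ to $t$ when reading $a$), an initial state $q_0\in Q$ and a set $F\subseteq Q$ of accepting states. The acceptance probability of a word $w=a_1\cdots a_m\in A^*$ is $$\mathbb P_{\mathcal A}(w)=\sum_{t\in F}\bigl(\delta_{q_0}M_{a_1}\cdots M_{a_m}\bigr)(t),$$ where $\delta_{q_0}$ is the row vector with entry $1$ at $q_0$ and $0$ elsewhere. The automaton is simple if all entries of all $M_a$ lie in $\{0,\tfrac12,1\}$. A probabilistic transition is a pair $(s,a)\in Q\times A$ such that $M_a(s,t)\notin\{0,1\}$ for some $t\in Q$. The isolation problem is: given a probabilistic automaton $\mathcal A$ (by its transition table, initial state and accepting states) and a rational number $\lambda\in[0,1]$, decide whether there are words accepted with probability arbitrarily close to $\lambda$, i.e. whether for every $\varepsilon>0$ there is $w\in A^*$ with $|\mathbb P_{\mathcal A}(w)-\lambda|<\varepsilon$.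 **Theorem.** The isolation problem is undecidable for simple probabilistic automata with exactly one probabilistic transition: there is no algorithm that, given any simple probabilistic automaton $\mathcal A$ with exactly one probabilistic transition and any rational $\lambda\in[0,1]$, halts and correctly answers whether there are words accepted by $\mathcal A$ with probability arbitrarily close to $\lambda$. -/

import Mathlib

/-- A probabilistic automaton with finite state set `Q` and finite alphabet `A`: rational
probabilistic transition matrices `trans a` (nonnegative, with rows summing to `1`, so that all
entries lie in `[0,1]`), an initial state and a set of accepting states. -/
structure ProbAutomaton (Q A : Type) [Fintype Q] where
  trans : A → Matrix Q Q ℚ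
  trans_nonneg : ∀ a s t, 0 ≤ trans a s t
  trans_sum : ∀ a s, ∑ t, trans a s t = 1
  init : Q
  accept : Finset Q

namespace ProbAutomaton

section
variable {Q A : Type} [Fintype Q] [DecidableEq Q]

/-- The distribution `δ · w` reached from the row vector `δ` after reading the word `w`. -/
def run (𝒜 : ProbAutomaton Q A) (δ : Q → ℚ) (w : List A) : Q → ℚ :=
  w.foldl (fun d a => Matrix.vecMul d (𝒜.trans a)) δ

/-- The acceptance probability of the word `w`. -/
def acceptProb (𝒜 : ProbAutomaton Q A) (w : List A) : ℚ :=
  ∑ t ∈ 𝒜.accept, 𝒜.run (Pi.single 𝒜.init 1) w t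

/-- All transition probabilities are `0`, `1/2` or `1`. -/
def IsSimple (𝒜 : ProbAutomaton Q A) : Prop :=
  ∀ a s t, 𝒜.trans a s t = 0 ∨ 𝒜.trans a s t = 1 / 2 ∨ 𝒜.trans a s t = 1

/-- The pair `p = (s, a)` is a probabilistic transition: `M_a(s, t) ∉ {0, 1}` for some `t`. -/
def IsProbTransition (𝒜 : ProbAutomaton Q A) (p : Q × A) : Prop :=
  ∃ t, 𝒜.trans p.2 p.1 t ≠ 0 ∧ 𝒜.trans p.2 p.1 t ≠ 1

/-- There is exactly one probabilistic transition. -/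
def HasOneProbTransition (𝒜 : ProbAutomaton Q A) : Prop :=
  ∃! p : Q × A, 𝒜.IsProbTransition p

/-- There are words whose acceptance probability is arbitrarily close to `lam`. -/
def HasWordsNear (𝒜 : ProbAutomaton Q A) (lam : ℚ) : Prop :=
  ∀ ε : ℚ, 0 < ε → ∃ w : List A, |𝒜.acceptProb w - lam| < ε

end

/-- Codes of rational numbers: numerator and denominator. -/
abbrev RatCode : Type := ℤ × ℕ

/-- Codes of automata: number of states, number of letters, the table of all transition
probabilities (indexed by letter, source state, target state), the initial state, and for each
state whether it is accepting. -/
abbrev Code : Type := ℕ × ℕ × List (List (List RatCode)) × ℕ × List Bool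

/-- The code of a rational number in lowest terms. -/
def encodeRat (q : ℚ) : RatCode := (q.num, q.den)

/-- The finite description of an automaton with states `0, …, n - 1` and letters `0, …, k - 1`
that is given to an algorithm as its input. -/
def encode {n k : ℕ} (𝒜 : ProbAutomaton (Fin n) (Fin k)) : Code :=
  (n, k,
    List.ofFn (fun a : Fin k => List.ofFn (fun s : Fin n => List.ofFn (fun t : Fin n =>
      encodeRat (𝒜.trans a s t)))),
    (𝒜.init : ℕ),
    List.ofFn (fun q : Fin n => decide (q ∈ 𝒜.accept)))

/-- The isolation problem is decidable for the automata of the class `C`: some algorithm (a partial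
recursive function), given any automaton of `C` and any rational `lam` in `[0,1]`, halts
and correctly answers whether there are words accepted with probability arbitrarily close
to `lam`. Nothing is required of it on other inputs. -/
def IsolationDecidable
    (C : ∀ {n k : ℕ}, ProbAutomaton (Fin n) (Fin k) → Prop) : Prop :=
  ∃ f : Code × RatCode →. Bool, Partrec f ∧
    ∀ (n k : ℕ) (𝒜 : ProbAutomaton (Fin n) (Fin k)), C 𝒜 →
      ∀ lam : ℚ, 0 ≤ lam → lam ≤ 1 →
        ∃ b ∈ f (encode 𝒜, encodeRat lam), (b = true ↔ 𝒜.HasWordsNear lam)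

end ProbAutomaton

/-! A single fixed automaton is already undecidable: the instance of the halting problem is carried
by `lam` alone. The starting point is a finite device that reads bits `u` and writes bits `v` along
a path (`TapeGraph`). If what it reads is what it wrote before, it acts as a queue machine, and the
acceptance probability measures how well the two agree.

A useful word puts mass 1/2 on a deterministic branch that follows a path of the device and 1/4 on
each of two tape states. All randomness comes from the one state `coin`, used as a subroutine: at
each edge the tape state concerned passes three times through `coin`, keeps a quarter of its weight,
and accepts an eighth or nothing according to the bit. This computes base-four expansions, so the
word is accepted with probability 1/2 + (`quaternary u` + `quaternary (v.map not)`)/8. Every other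
word is accepted with probability at most 1/2 (`acceptProb_le_half_or`), because `coin` holds at
most half of the mass after the first letter.

The probability is near 1/2 + 1/24 when `u` and `v` have a long common prefix. Moving the target by
4^-(n+1)/8 forces `v` to begin with n + 1 zeros and `10`, and `u` with n zeros and `110`; this hands
n to the device as its input (`le_abs_shiftedDefect`). If the queue machine runs forever on n,
agreement gets arbitrarily long; if it halts, every path stops early or disagrees early, which
leaves a gap (`Gap`). Queue machines simulate the four-stack machines that compute all partial
recursive functions. -/

namespace ProbAutomaton

/-! ### Acceptance probabilities as backward expectations -/

section
variable {Q A : Type} [Fintype Q]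

/-- The expectation of the terminal weight `φ` after reading a word, as a function of the
starting state. -/
def value (𝒜 : ProbAutomaton Q A) (φ : Q → ℚ) : List A → Q → ℚ
  | [] => φ
  | a :: w => fun s => ∑ t, 𝒜.trans a s t * 𝒜.value φ w t

/-- Transporting distributions forward is adjoint to transporting weights backward. The backward
form allows induction on the first letter from every state at once. -/
theorem sum_run_mul (𝒜 : ProbAutomaton Q A) (φ : Q → ℚ) (w : List A) (x : Q → ℚ) :
    ∑ t, 𝒜.run x w t * φ t = ∑ s, x s * 𝒜.value φ w s := by
  induction w generalizing x with
  | nil => rfl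
  | cons a w ih =>
    have h : 𝒜.run x (a :: w) = 𝒜.run (Matrix.vecMul x (𝒜.trans a)) w := rfl
    rw [h, ih]
    simp only [value, Matrix.vecMul, dotProduct, Finset.sum_mul, Finset.mul_sum]
    rw [Finset.sum_comm]
    simp only [mul_assoc]

theorem acceptProb_eq_value [DecidableEq Q] (𝒜 : ProbAutomaton Q A) (w : List A) :
    𝒜.acceptProb w = 𝒜.value (fun t => if t ∈ 𝒜.accept then 1 else 0) w 𝒜.init := by
  have h := 𝒜.sum_run_mul (fun t => if t ∈ 𝒜.accept then 1 else 0) w (Pi.single 𝒜.init 1)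
  simp only [mul_ite, mul_one, mul_zero, Finset.sum_ite_mem, Finset.univ_inter] at h
  rw [acceptProb, h]
  simp [Pi.single_apply]

theorem value_append (𝒜 : ProbAutomaton Q A) (φ : Q → ℚ) (w w' : List A) :
    𝒜.value φ (w ++ w') = 𝒜.value (𝒜.value φ w') w := by
  induction w with
  | nil => rfl
  | cons a w ih => simp only [List.cons_append, value, ih]

theorem value_mono (𝒜 : ProbAutomaton Q A) {φ ψ : Q → ℚ} (h : ∀ t, φ t ≤ ψ t) (w : List A)
    (s : Q) : 𝒜.value φ w s ≤ 𝒜.value ψ w s := by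
  induction w generalizing s with
  | nil => exact h s
  | cons a w ih =>
    exact Finset.sum_le_sum fun t _ => mul_le_mul_of_nonneg_left (ih t) (𝒜.trans_nonneg a s t)

theorem value_const (𝒜 : ProbAutomaton Q A) (c : ℚ) (w : List A) (s : Q) :
    𝒜.value (fun _ => c) w s = c := by
  induction w generalizing s with
  | nil => rfl
  | cons a w ih => simp only [value, ih, ← Finset.sum_mul, 𝒜.trans_sum, one_mul]

theorem value_le (𝒜 : ProbAutomaton Q A) {φ : Q → ℚ} {c : ℚ} (h : ∀ t, φ t ≤ c) (w : List A)
    (s : Q) : 𝒜.value φ w s ≤ c :=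
  (𝒜.value_mono h w s).trans_eq (𝒜.value_const c w s)

theorem value_add (𝒜 : ProbAutomaton Q A) (φ ψ : Q → ℚ) (w : List A) (s : Q) :
    𝒜.value (fun t => φ t + ψ t) w s = 𝒜.value φ w s + 𝒜.value ψ w s := by
  induction w generalizing s with
  | nil => rfl
  | cons a w ih => simp only [value, ih, mul_add, Finset.sum_add_distrib]

end

end ProbAutomaton

/-! ### Two-tape devices and their automata with one coin flip -/

/-- A finite-state device with two binary tapes: a node reads one bit from the input tape or writes
one bit to the output tape, and moves on according to that bit. -/
structure TapeGraph (D : Type) where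
  reads : D → Bool
  next : D → Bool → Option D
  final : D → Bool

namespace TapeGraph

/-- `G.Path d u v e`: there is a path from `d` to `e` that reads `u` and writes `v`. -/
inductive Path {D : Type} (G : TapeGraph D) : D → List Bool → List Bool → D → Prop
  | nil (d : D) : Path G d [] [] d
  | read {d b d' u v e} : G.reads d = true → G.next d b = some d' → Path G d' u v e →
      Path G d (b :: u) v e
  | write {d b d' u v e} : G.reads d = false → G.next d b = some d' → Path G d' u v e →
      Path G d u (b :: v) e

/-- States of the automaton of a tape graph. -/
inductive State (D : Type)
  | coin | heads | tails | dead | acc | forked | flipped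
  | tape (t : Bool)
  | main (d : D)
  | busy (i : Fin 3) (flipped : Bool) (d : D) (b : Bool)
  deriving DecidableEq, Fintype

/-- Letters of the automaton of a tape graph. -/
inductive Letter (D : Type)
  | flip | fork | start
  | call (d : D) (b : Bool)
  | keep (d : D) (b : Bool)
  | split (d : D) (b : Bool)
  | ret (d : D) (b : Bool)
  deriving DecidableEq, Fintype

variable {D : Type} [DecidableEq D]

open State Letter

/-- The successor of a state under a letter, apart from the coin flip. -/
def move (G : TapeGraph D) (d₀ : D) : Letter D → State D → State D
  | _, dead => dead
  | .flip, acc => acc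
  | .flip, tape t => tape t
  | .flip, forked => .flipped
  | .flip, busy i f d b => if f then dead else busy i true d b
  | fork, heads => forked
  | fork, tails => coin
  | start, heads => tape true
  | start, tails => tape false
  | start, .flipped => main d₀
  | call d b, main d' => if d' = d ∧ (G.next d b).isSome then busy 0 false d b else dead
  | call d _, tape t => if G.reads d = t then coin else tape t
  | keep d b, busy i f d' b' =>
      if i = 0 ∧ f = true ∧ d' = d ∧ b' = b then busy 1 false d b else dead
  | keep _ _, heads => coin
  | keep _ _, tape t => tape t
  | split d b, busy i f d' b' =>
      if i = 1 ∧ f = true ∧ d' = d ∧ b' = b then busy 2 false d b else dead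
  | split d _, heads => tape (G.reads d)
  | split _ _, tails => coin
  -- In a proper call this tape has already moved to `coin`. Killing stray weight here leaves `tape
  -- t` with only one predecessor under `split`, as `hits_tape_le_half` needs.
  | split d _, tape t => if G.reads d = t then dead else tape t
  | ret d b, busy i f d' b' =>
      if i = 2 ∧ f = true ∧ d' = d ∧ b' = b then (G.next d b).elim dead main else dead
  | ret d b, heads => if G.reads d = b then acc else dead
  | ret _ _, tape t => tape t
  | call _ _, acc => acc
  | keep _ _, acc => acc
  | split _ _, acc => acc
  | ret _ _, acc => acc
  | _, _ => dead

/-- The accepting states of the automaton of a tape graph. -/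
def accepting (G : TapeGraph D) : State D → Bool
  | acc => true
  | main d => G.final d
  | _ => false

variable [Fintype D]

/-- The probabilistic automaton of a tape graph: its only probabilistic transition is the coin
flip, from the state `coin` under the letter `flip`. -/
def automaton (G : TapeGraph D) (d₀ : D) : ProbAutomaton (State D) (Letter D) where
  trans a := fun s t =>
    if a = .flip ∧ s = coin then (if t = heads then 1 / 2 else 0) + (if t = tails then 1 / 2 else 0)
    else if t = G.move d₀ a s then 1 else 0
  trans_nonneg a s t := by
    split_ifs <;> norm_num
  trans_sum a s := by
    split_ifs with h
    · rw [Finset.sum_add_distrib]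
      simp only [Finset.sum_ite_eq', Finset.mem_univ, if_true]
      norm_num
    · simp
  init := coin
  accept := Finset.univ.filter fun s => G.accepting s = true

variable (G : TapeGraph D) (d₀ : D)

theorem isSimple_automaton : (G.automaton d₀).IsSimple := by
  intro a s t
  simp only [automaton]
  split_ifs with h₁ h₂ h₃ <;> simp_all

theorem hasOneProbTransition_automaton : (G.automaton d₀).HasOneProbTransition := by
  refine ⟨(coin, .flip), ⟨heads, ?_⟩, ?_⟩
  · simp [automaton]
  · rintro ⟨s, a⟩ ⟨t, h⟩
    simp only [automaton] at h
    split_ifs at h <;> simp_all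

theorem value_cons_of_ne {φ : State D → ℚ} {a : Letter D} {w : List (Letter D)} {s : State D}
    (h : ¬ (a = .flip ∧ s = coin)) :
    (G.automaton d₀).value φ (a :: w) s = (G.automaton d₀).value φ w (G.move d₀ a s) := by
  simp [ProbAutomaton.value, automaton, h]

theorem value_flip_coin {φ : State D → ℚ} {w : List (Letter D)} :
    (G.automaton d₀).value φ (.flip :: w) coin =
      ((G.automaton d₀).value φ w heads + (G.automaton d₀).value φ w tails) / 2 := by
  simp only [ProbAutomaton.value, automaton, and_self, if_true, add_mul, ite_mul, zero_mul,
    Finset.sum_add_distrib, Finset.sum_ite_eq', Finset.mem_univ]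
  ring

/-- The probability of accepting `w` from a given state. -/
def acceptFrom (w : List (Letter D)) (s : State D) : ℚ :=
  (G.automaton d₀).value (fun t => if G.accepting t then 1 else 0) w s

theorem acceptFrom_nil (s : State D) :
    G.acceptFrom d₀ [] s = if G.accepting s then 1 else 0 := rfl

theorem acceptProb_automaton (w : List (Letter D)) :
    (G.automaton d₀).acceptProb w = G.acceptFrom d₀ w coin := by
  rw [ProbAutomaton.acceptProb_eq_value]
  simp [acceptFrom, automaton]

theorem acceptFrom_cons {a : Letter D} {w : List (Letter D)} {s : State D}
    (h : ¬ (a = .flip ∧ s = coin)) :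
    G.acceptFrom d₀ (a :: w) s = G.acceptFrom d₀ w (G.move d₀ a s) :=
  G.value_cons_of_ne d₀ h

theorem acceptFrom_flip_coin (w : List (Letter D)) :
    G.acceptFrom d₀ (.flip :: w) coin =
      (G.acceptFrom d₀ w heads + G.acceptFrom d₀ w tails) / 2 :=
  G.value_flip_coin d₀

theorem acceptFrom_le_one (w : List (Letter D)) (s : State D) : G.acceptFrom d₀ w s ≤ 1 :=
  ProbAutomaton.value_le _ (fun t => by split_ifs <;> norm_num) w s

omit [Fintype D] in
theorem move_dead (a : Letter D) : G.move d₀ a dead = dead := by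
  cases a <;> rfl

theorem acceptFrom_dead (w : List (Letter D)) : G.acceptFrom d₀ w dead = 0 := by
  induction w with
  | nil => rfl
  | cons a w ih => rw [acceptFrom_cons _ _ (by simp), move_dead, ih]

/-! ### Words accepted with probability above one half -/

/-- Without the letter `fork`, at most half of the mass of any part can be accepted. -/
theorem acceptFrom_le_half {w : List (Letter D)} (hw : fork ∉ w) :
    G.acceptFrom d₀ w coin ≤ 1 / 2 ∧ (∀ t, G.acceptFrom d₀ w (tape t) ≤ 1 / 2) ∧
      G.acceptFrom d₀ w heads + G.acceptFrom d₀ w tails ≤ 1 := by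
  induction w with
  | nil => simp [acceptFrom_nil, accepting]
  | cons a w ih =>
    obtain ⟨h₁, h₂, h₃⟩ := ih fun h => hw (List.mem_cons_of_mem _ h)
    have h₀ := G.acceptFrom_dead d₀ w
    have hA := G.acceptFrom_le_one d₀ w acc
    have ht := h₂ true
    have hf := h₂ false
    refine ⟨?_, fun t => ?_, ?_⟩
    · by_cases ha : a = .flip
      · subst ha
        rw [acceptFrom_flip_coin]
        linarith
      · rw [acceptFrom_cons _ _ (by simp [ha])]
        have : G.move d₀ a coin = dead := by cases a <;> simp_all [move]
        rw [this, h₀]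
        norm_num
    · rw [acceptFrom_cons _ _ (by simp)]
      have : G.move d₀ a (tape t) ∈ ({dead, coin, tape t} : Set (State D)) := by
        cases a <;> simp only [move] <;> (try split_ifs) <;> simp
      rcases this with h | h | h <;> rw [h]
      · rw [h₀]; norm_num
      · exact h₁
      · exact h₂ t
    · rw [acceptFrom_cons _ _ (by simp), acceptFrom_cons _ _ (by simp)]
      -- Except for `fork`, every letter either kills `tails`, or sends `heads` and `tails` to two
      -- states of value at most 1/2 each.
      cases a with
      | flip => simp only [move, h₀]; norm_num
      | fork => simp at hw
      | start => simp only [move]; linarith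
      | call d b => simp only [move, h₀]; norm_num
      | keep d b => simp only [move, h₀]; linarith
      | split d b => simp only [move]; linarith [h₂ (G.reads d)]
      | ret d b =>
        simp only [move]
        split_ifs <;> linarith

/-- The probability of being in the state `s` after reading `w`. -/
def hits (s : State D) (w : List (Letter D)) : ℚ :=
  (G.automaton d₀).value (fun t => if t = s then 1 else 0) w coin

theorem hits_nil (s : State D) : G.hits d₀ s [] = if coin = s then 1 else 0 := rfl

theorem hits_append_le {s s' : State D} {a : Letter D} (w : List (Letter D))
    (h : ∀ t, (G.automaton d₀).value (fun t => if t = s then 1 else 0) [a] t ≤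
      if t = s' then 1 else 0) : G.hits d₀ s (w ++ [a]) ≤ G.hits d₀ s' w := by
  unfold hits
  rw [ProbAutomaton.value_append]
  exact ProbAutomaton.value_mono _ h w coin

/-- Where a state has a unique predecessor, mass cannot accumulate. The states `heads` and `tails`
are excluded because the coin flip enters them. -/
theorem hits_append_le_of_move {s s' : State D} {a : Letter D} (w : List (Letter D))
    (hs : s ≠ heads ∧ s ≠ tails) (h : ∀ t, G.move d₀ a t = s → t = s') :
    G.hits d₀ s (w ++ [a]) ≤ G.hits d₀ s' w := by
  refine G.hits_append_le d₀ w fun t => ?_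
  by_cases hc : a = .flip ∧ t = coin
  · obtain ⟨rfl, rfl⟩ := hc
    rw [value_flip_coin]
    simp only [ProbAutomaton.value, hs.1.symm, hs.2.symm, if_false]
    split_ifs <;> norm_num
  · rw [value_cons_of_ne _ _ hc]
    by_cases hm : G.move d₀ a t = s
    · simp [ProbAutomaton.value, h t hm, ← hm]
    · simp only [ProbAutomaton.value, hm, if_false]
      split_ifs <;> norm_num

omit [Fintype D] in
theorem move_ne_heads_tails (a : Letter D) (s : State D) :
    G.move d₀ a s ≠ heads ∧ G.move d₀ a s ≠ tails := by
  fun_cases TapeGraph.move <;> simp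
  all_goals cases G.next _ _ <;> simp

/-- Each side is entered only by the coin flip, which sends there half of the mass of `coin`. -/
theorem hits_side_le_half (s : State D) (hs : s = heads ∨ s = tails) (w : List (Letter D)) :
    G.hits d₀ s w ≤ 1 / 2 := by
  rcases List.eq_nil_or_concat w with rfl | ⟨w, a, rfl⟩
  · rcases hs with rfl | rfl <;> simp [hits_nil]
  · unfold hits
    rw [List.concat_eq_append, ProbAutomaton.value_append]
    refine ProbAutomaton.value_le _ (fun t => ?_) w coin
    by_cases hc : a = .flip ∧ t = coin
    · obtain ⟨rfl, rfl⟩ := hc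
      rw [value_flip_coin]
      rcases hs with rfl | rfl <;> simp [ProbAutomaton.value]
    · rw [value_cons_of_ne _ _ hc]
      have h := G.move_ne_heads_tails d₀ a t
      rcases hs with rfl | rfl <;> simp [ProbAutomaton.value, h]

/-- Under each letter all mass arriving in `tape t` comes from one state: a side of the coin, or
`tape t` itself. The bound is inherited. -/
theorem hits_tape_le_half (t : Bool) (w : List (Letter D)) : G.hits d₀ (tape t) w ≤ 1 / 2 := by
  induction w using List.reverseRecOn with
  | nil => simp [hits_nil]
  | append_singleton w a ih =>
    have key : ∃ s', (s' = heads ∨ s' = tails ∨ s' = tape t) ∧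
        ∀ s, G.move d₀ a s = tape t → s = s' := by
      cases a with
      | start =>
        refine ⟨if t then heads else tails, by cases t <;> simp, fun s hs => ?_⟩
        cases s <;> simp_all [move]
      | split d b =>
        refine ⟨if G.reads d = t then heads else tape t, by split_ifs <;> simp, fun s hs => ?_⟩
        cases s <;> simp only [move] at hs <;> (try split_ifs at hs) <;> simp_all
      | _ =>
        refine ⟨tape t, by simp, fun s hs => ?_⟩
        cases s <;> simp only [move] at hs <;> (try split_ifs at hs) <;> simp_all
        all_goals
          generalize G.next _ _ = o at hs
          cases o <;> simp at hs
    obtain ⟨s', hs', h⟩ := key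
    refine (G.hits_append_le_of_move d₀ w (by simp) h).trans ?_
    rcases hs' with rfl | rfl | rfl
    · exact G.hits_side_le_half d₀ _ (Or.inl rfl) w
    · exact G.hits_side_le_half d₀ _ (Or.inr rfl) w
    · exact ih

/-- Under each letter all mass arriving in `coin` comes from one side of the coin or from one tape,
never from `coin` itself. The empty word is excluded since all mass starts in `coin`. -/
theorem hits_coin_le_half {w : List (Letter D)} (hw : w ≠ []) : G.hits d₀ coin w ≤ 1 / 2 := by
  rcases List.eq_nil_or_concat w with rfl | ⟨w, a, rfl⟩
  · exact absurd rfl hw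
  rw [List.concat_eq_append]
  have key : ∃ s', (s' = heads ∨ s' = tails ∨ ∃ t, s' = tape t) ∧
      ∀ s, G.move d₀ a s = coin → s = s' := by
    refine ⟨match a with
      | fork => tails
      | keep _ _ => heads
      | split _ _ => tails
      | call d _ => tape (G.reads d)
      | _ => heads, by cases a <;> simp, fun s hs => ?_⟩
    cases a <;> cases s <;> simp only [move] at hs <;> (try split_ifs at hs) <;> simp_all
    generalize G.next _ _ = o at hs
    cases o <;> simp at hs
  obtain ⟨s', hs', h⟩ := key
  refine (G.hits_append_le_of_move d₀ w (by simp) h).trans ?_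
  rcases hs' with rfl | rfl | ⟨t, rfl⟩
  · exact G.hits_side_le_half d₀ _ (Or.inl rfl) w
  · exact G.hits_side_le_half d₀ _ (Or.inr rfl) w
  · exact G.hits_tape_le_half d₀ t w

/-- Both sides together hold what `coin` held one letter earlier; this exceeds 1/2 only when the
flip is the first letter. -/
theorem hits_heads_add_tails_le {w : List (Letter D)} (hw : w ≠ [.flip]) :
    G.hits d₀ heads w + G.hits d₀ tails w ≤ 1 / 2 := by
  rcases List.eq_nil_or_concat w with rfl | ⟨w, a, rfl⟩
  · simp [hits_nil]
  rw [List.concat_eq_append] at hw ⊢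
  by_cases ha : a = .flip
  · subst ha
    refine le_trans ?_ (G.hits_coin_le_half d₀ (w := w) (by rintro rfl; simp at hw))
    unfold hits
    rw [← ProbAutomaton.value_add, ProbAutomaton.value_append]
    refine ProbAutomaton.value_mono _ (fun t => ?_) w coin
    by_cases hc : t = coin
    · subst hc
      rw [value_flip_coin]
      simp [ProbAutomaton.value]
    · rw [value_cons_of_ne _ _ (by simp [hc])]
      have h := G.move_ne_heads_tails d₀ .flip t
      simp [ProbAutomaton.value, h, hc]
  · unfold hits
    rw [← ProbAutomaton.value_add, ProbAutomaton.value_append]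
    refine ProbAutomaton.value_le _ (fun t => ?_) w coin
    rw [value_cons_of_ne _ _ (by simp [ha])]
    have h := G.move_ne_heads_tails d₀ a t
    simp [ProbAutomaton.value, h]

/-- The letter `fork` kills everything outside `heads` and `tails`, so a late `fork` leaves at most
half of the mass. -/
theorem value_fork_le {w w' : List (Letter D)} (hw : w ≠ [.flip]) :
    G.acceptFrom d₀ (w ++ fork :: w') coin ≤ 1 / 2 := by
  refine le_trans ?_ (G.hits_heads_add_tails_le d₀ hw)
  unfold acceptFrom hits
  rw [← ProbAutomaton.value_add, ProbAutomaton.value_append]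
  refine ProbAutomaton.value_mono _ (fun t => ?_) w coin
  change G.acceptFrom d₀ (fork :: w') t ≤ _
  rw [acceptFrom_cons _ _ (by simp)]
  cases t <;> simp [move, acceptFrom_dead, acceptFrom_le_one]

/-- A word accepted with probability above one half starts by isolating a half of the mass in the
part of the automaton that checks the word. -/
theorem exists_eq_of_half_lt {w : List (Letter D)} (h : 1 / 2 < G.acceptFrom d₀ w coin) :
    ∃ w', w = .flip :: fork :: w' ∧ G.acceptFrom d₀ w' forked ≠ 0 := by
  have hf : fork ∈ w := by
    by_contra hf
    exact absurd (G.acceptFrom_le_half d₀ hf).1 (not_le.2 h)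
  obtain ⟨w₁, w₂, rfl⟩ := List.append_of_mem hf
  by_cases hw : w₁ = [.flip]
  · subst hw
    -- If the half in `forked` were lost, the other half could contribute at most 1/2.
    refine ⟨w₂, rfl, fun h0 => ?_⟩
    have h1 := G.acceptFrom_le_one d₀ w₂ coin
    rw [List.singleton_append, acceptFrom_flip_coin, acceptFrom_cons _ _ (by simp),
      acceptFrom_cons _ _ (by simp)] at h
    simp only [move, h0] at h
    linarith
  · exact absurd (G.value_fork_le d₀ hw) (not_le.2 h)

/-- The word that makes the automaton follow the edge labelled `b` from the node `d`. -/
def edgeWord (d : D) (b : Bool) : List (Letter D) :=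
  [call d b, .flip, keep d b, .flip, split d b, .flip, ret d b]

theorem acceptFrom_edgeWord_main {d d' : D} {b : Bool} (h : G.next d b = some d')
    (w : List (Letter D)) :
    G.acceptFrom d₀ (edgeWord d b ++ w) (main d) = G.acceptFrom d₀ w (main d') := by
  simp [edgeWord, acceptFrom_cons, move, h]

theorem acceptFrom_edgeWord_acc {d : D} {b : Bool} (w : List (Letter D)) :
    G.acceptFrom d₀ (edgeWord d b ++ w) acc = G.acceptFrom d₀ w acc := by
  simp [edgeWord, acceptFrom_cons, move]

/-- The first flip retains one half; the second returns a quarter to the tape and a quarter to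
`coin`; the third brings an eighth to `heads`, accepted if the bit equals `G.reads d`. Thus the
input tape counts ones and the output tape counts zeros, which is why `v` appears complemented. -/
theorem acceptFrom_edgeWord_tape {d : D} {b : Bool} {w : List (Letter D)}
    (hA : G.acceptFrom d₀ w acc = 1) :
    G.acceptFrom d₀ (edgeWord d b ++ w) (tape (G.reads d)) =
      (G.acceptFrom d₀ w (tape (G.reads d)) + if G.reads d = b then 1 / 2 else 0) / 4 := by
  simp only [edgeWord, List.cons_append, List.nil_append, acceptFrom_cons, move,
    acceptFrom_flip_coin, reduceCtorEq, and_false, not_false_eq_true, if_true, acceptFrom_dead]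
  split_ifs <;> simp [acceptFrom_dead, hA] <;> ring

theorem acceptFrom_edgeWord_tape_of_ne {d : D} {b t : Bool} (ht : G.reads d ≠ t)
    (w : List (Letter D)) :
    G.acceptFrom d₀ (edgeWord d b ++ w) (tape t) = G.acceptFrom d₀ w (tape t) := by
  simp [edgeWord, acceptFrom_cons, move, ht]

/-- The stage `i` and the flag in `busy` dictate the word: one flip, then the one letter belonging
to the stage. Anything else leads to `dead`. -/
theorem acceptFrom_busy_ne_zero {i : Fin 3} {d : D} {b : Bool} {w : List (Letter D)}
    (h : G.acceptFrom d₀ w (busy i false d b) ≠ 0) :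
    ∃ a w' s, w = .flip :: a :: w' ∧ G.acceptFrom d₀ w' s ≠ 0 ∧
      (i = 0 ∧ a = keep d b ∧ s = busy 1 false d b ∨
        i = 1 ∧ a = split d b ∧ s = busy 2 false d b ∨
        i = 2 ∧ a = ret d b ∧ ∃ d', G.next d b = some d' ∧ s = main d') := by
  obtain _ | ⟨a, w⟩ := w
  · simp [acceptFrom_nil, accepting] at h
  rw [acceptFrom_cons _ _ (by simp)] at h
  cases a <;> simp only [move, acceptFrom_dead, ne_eq, not_true, if_false, Bool.false_eq_true,
    and_false, false_and] at h
  obtain _ | ⟨a, w⟩ := w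
  · simp [acceptFrom_nil, accepting] at h
  rw [acceptFrom_cons _ _ (by simp)] at h
  refine ⟨a, w, _, rfl, h, ?_⟩
  cases a <;> simp only [move, if_true, acceptFrom_dead, not_true] at h ⊢
  all_goals split_ifs at h ⊢ with hi <;> (try simp only [acceptFrom_dead, not_true] at h)
  · obtain ⟨rfl, -, rfl, rfl⟩ := hi
    simp
  · obtain ⟨rfl, -, rfl, rfl⟩ := hi
    simp
  · obtain ⟨rfl, -, rfl, rfl⟩ := hi
    cases hn : G.next d b with
    | none => simp [hn, acceptFrom_dead] at h
    | some d' => simp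

/-- The deterministic branch thus polices the calls: it survives only complete edge words along
existing edges. -/
theorem acceptFrom_main_ne_zero {d : D} {w : List (Letter D)}
    (h : G.acceptFrom d₀ w (main d) ≠ 0) :
    (w = [] ∧ G.final d = true) ∨ ∃ b d' w', G.next d b = some d' ∧ w = edgeWord d b ++ w' ∧
      G.acceptFrom d₀ w' (main d') ≠ 0 := by
  obtain _ | ⟨a, w⟩ := w
  · refine Or.inl ⟨rfl, ?_⟩
    by_contra hf
    simp [acceptFrom_nil, accepting, hf] at h
  rw [acceptFrom_cons _ _ (by simp)] at h
  cases a <;> simp only [move, acceptFrom_dead, ne_eq, not_true] at h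
  rename_i d' b
  split_ifs at h with hd <;> (try simp only [acceptFrom_dead, not_true] at h)
  obtain ⟨rfl, -⟩ := hd
  obtain ⟨a, w, s, rfl, h, hs⟩ := G.acceptFrom_busy_ne_zero d₀ h
  obtain ⟨-, rfl, rfl⟩ : (0 : Fin 3) = 0 ∧ a = keep d b ∧ s = busy 1 false d b := by simpa using hs
  obtain ⟨a, w, s, rfl, h, hs⟩ := G.acceptFrom_busy_ne_zero d₀ h
  obtain ⟨rfl, rfl⟩ : a = split d b ∧ s = busy 2 false d b := by simpa using hs
  obtain ⟨a, w, s, rfl, h, hs⟩ := G.acceptFrom_busy_ne_zero d₀ h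
  obtain ⟨rfl, d', hd', rfl⟩ : a = ret d b ∧ ∃ d', G.next d b = some d' ∧ s = main d' := by
    simpa using hs
  exact Or.inr ⟨b, d', w, hd', rfl, h⟩

end TapeGraph

/-! ### Acceptance probabilities of paths -/

/-- The number with the given base-four digits (each of them `0` or `1`) after the point. -/
def quaternary : List Bool → ℚ
  | [] => 0
  | b :: u => ((if b then 1 else 0) + quaternary u) / 4

namespace TapeGraph

open State Letter

variable {D : Type} [DecidableEq D] [Fintype D] (G : TapeGraph D) (d₀ : D)

/-- The word `w` follows from the node `d` a path that reads `u` and writes `v`. -/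
structure Follows (d : D) (w : List (Letter D)) (u v : List Bool) : Prop where
  main : G.acceptFrom d₀ w (main d) = 1
  acc : G.acceptFrom d₀ w acc = 1
  input : G.acceptFrom d₀ w (tape true) = quaternary u / 2
  output : G.acceptFrom d₀ w (tape false) = quaternary (v.map not) / 2

theorem follows_nil {d : D} (h : G.final d = true) : G.Follows d₀ d [] [] [] :=
  ⟨by simp [acceptFrom_nil, accepting, h], by simp [acceptFrom_nil, accepting],
    by simp [acceptFrom_nil, accepting, quaternary], by simp [acceptFrom_nil, accepting, quaternary]⟩

theorem Follows.read {d d' : D} {b : Bool} {w : List (Letter D)} {u v : List Bool}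
    (hd : G.reads d = true) (hn : G.next d b = some d') (h : G.Follows d₀ d' w u v) :
    G.Follows d₀ d (edgeWord d b ++ w) (b :: u) v where
  main := by rw [acceptFrom_edgeWord_main _ _ hn, h.main]
  acc := by rw [acceptFrom_edgeWord_acc, h.acc]
  input := by
    rw [← hd, acceptFrom_edgeWord_tape _ _ h.acc, hd, h.input]
    cases b <;> simp [quaternary] <;> ring
  output := by rw [acceptFrom_edgeWord_tape_of_ne _ _ (by simp [hd]), h.output]

theorem Follows.write {d d' : D} {b : Bool} {w : List (Letter D)} {u v : List Bool}
    (hd : G.reads d = false) (hn : G.next d b = some d') (h : G.Follows d₀ d' w u v) :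
    G.Follows d₀ d (edgeWord d b ++ w) u (b :: v) where
  main := by rw [acceptFrom_edgeWord_main _ _ hn, h.main]
  acc := by rw [acceptFrom_edgeWord_acc, h.acc]
  input := by rw [acceptFrom_edgeWord_tape_of_ne _ _ (by simp [hd]), h.input]
  output := by
    rw [← hd, acceptFrom_edgeWord_tape _ _ h.acc, hd, h.output]
    cases b <;> simp [quaternary] <;> ring

theorem Path.exists_follows {d e : D} {u v : List Bool} (h : G.Path d u v e)
    (he : G.final e = true) : ∃ w, G.Follows d₀ d w u v := by
  induction h with
  | nil d => exact ⟨[], G.follows_nil d₀ he⟩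
  | read hd hn _ ih =>
    obtain ⟨w, hw⟩ := ih he
    exact ⟨_, hw.read G d₀ hd hn⟩
  | write hd hn _ ih =>
    obtain ⟨w, hw⟩ := ih he
    exact ⟨_, hw.write G d₀ hd hn⟩

theorem exists_path_follows {d : D} {w : List (Letter D)}
    (h : G.acceptFrom d₀ w (State.main d) ≠ 0) :
    ∃ u v e, G.Path d u v e ∧ G.final e = true ∧ G.Follows d₀ d w u v := by
  induction hl : w.length using Nat.strong_induction_on generalizing d w with
  | _ n ih =>
    obtain ⟨rfl, hd⟩ | ⟨b, d', w', hn, rfl, h'⟩ := G.acceptFrom_main_ne_zero d₀ h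
    · exact ⟨[], [], d, .nil d, hd, G.follows_nil d₀ hd⟩
    · obtain ⟨u, v, e, hp, he, hf⟩ := ih w'.length (by simp [← hl, edgeWord]; omega) h' rfl
      cases hd : G.reads d with
      | true => exact ⟨b :: u, v, e, hp.read hd hn, he, hf.read G d₀ hd hn⟩
      | false => exact ⟨u, b :: v, e, hp.write hd hn, he, hf.write G d₀ hd hn⟩

/-- The prefix leaves mass 1/2 in `main d₀` and 1/4 in each tape state. -/
theorem Follows.acceptProb_eq {w : List (Letter D)} {u v : List Bool}
    (h : G.Follows d₀ d₀ w u v) :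
    (G.automaton d₀).acceptProb (.flip :: fork :: .flip :: start :: w) =
      1 / 2 + (quaternary u + quaternary (v.map not)) / 8 := by
  simp only [acceptProb_automaton, acceptFrom_flip_coin, acceptFrom_cons, move, reduceCtorEq,
    and_false, not_false_eq_true, h.main, h.input, h.output]
  ring

theorem exists_acceptProb_eq {u v : List Bool} {e : D} (h : G.Path d₀ u v e)
    (he : G.final e = true) : ∃ w, (G.automaton d₀).acceptProb w =
      1 / 2 + (quaternary u + quaternary (v.map not)) / 8 := by
  obtain ⟨w, hw⟩ := h.exists_follows G d₀ he
  exact ⟨_, hw.acceptProb_eq⟩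

/-- Above 1/2 the deterministic branch must accept, and it does so only for words spelling a path;
the probability is then determined by that path. -/
theorem acceptProb_le_half_or (w : List (Letter D)) :
    (G.automaton d₀).acceptProb w ≤ 1 / 2 ∨ ∃ u v e, G.Path d₀ u v e ∧ G.final e = true ∧
      (G.automaton d₀).acceptProb w =
        1 / 2 + (quaternary u + quaternary (v.map not)) / 8 := by
  refine or_iff_not_imp_left.2 fun h => ?_
  rw [not_le, acceptProb_automaton] at h
  obtain ⟨w, rfl, hw⟩ := G.exists_eq_of_half_lt d₀ h
  obtain ⟨w', rfl, hw'⟩ : ∃ w', w = .flip :: start :: w' ∧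
      G.acceptFrom d₀ w' (main d₀) ≠ 0 := by
    obtain _ | ⟨a, w⟩ := w
    · simp [acceptFrom_nil, accepting] at hw
    rw [acceptFrom_cons _ _ (by simp)] at hw
    cases a <;> simp only [move, acceptFrom_dead, ne_eq, not_true] at hw
    obtain _ | ⟨a, w⟩ := w
    · simp [acceptFrom_nil, accepting] at hw
    rw [acceptFrom_cons _ _ (by simp)] at hw
    cases a <;> simp only [move, acceptFrom_dead, not_true] at hw
    exact ⟨w, rfl, hw⟩
  obtain ⟨u, v, e, hp, he, hf⟩ := G.exists_path_follows d₀ hw'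
  exact ⟨u, v, e, hp, he, hf.acceptProb_eq⟩

end TapeGraph

/-! ### Comparing base-four expansions -/

theorem quaternary_nonneg (u : List Bool) : 0 ≤ quaternary u := by
  induction u with
  | nil => exact le_rfl
  | cons b u ih => simp only [quaternary]; split_ifs <;> linarith

theorem quaternary_lt (u : List Bool) : quaternary u < 1 / 3 := by
  induction u with
  | nil => norm_num [quaternary]
  | cons b u ih => simp only [quaternary]; split_ifs <;> linarith

/-- The difference between the number with base-four digits `u` and the number with base-four digits
`v`, where `v` is continued by ones and `u` by zeros. -/
def defect (u v : List Bool) : ℚ := quaternary u + quaternary (v.map not) - 1 / 3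

/-- As `defect`, with `1` added to the digit of `v` of index `n`. -/
def shiftedDefect (n : ℕ) (u v : List Bool) : ℚ := defect u v - 1 / 4 ^ (n + 1)

theorem defect_cons_cons (a b : Bool) (u v : List Bool) :
    defect (a :: u) (b :: v) =
      ((if a then 1 else 0) - (if b then 1 else 0) + defect u v) / 4 := by
  cases a <;> cases b <;> simp [defect, quaternary] <;> ring

theorem defect_bounds (u v : List Bool) : -1 / 3 ≤ defect u v ∧ defect u v ≤ 1 / 3 := by
  have h₁ := quaternary_nonneg u
  have h₂ := quaternary_lt u
  have h₃ := quaternary_nonneg (v.map not)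
  have h₄ := quaternary_lt (v.map not)
  unfold defect
  constructor <;> linarith

theorem defect_nil_neg (v : List Bool) : defect [] v < 0 := by
  have := quaternary_lt (v.map not)
  simp only [defect, quaternary]
  linarith

theorem defect_append_append (p u v : List Bool) :
    defect (p ++ u) (p ++ v) = defect u v / 4 ^ p.length := by
  induction p with
  | nil => simp
  | cons a p ih =>
    rw [List.cons_append, List.cons_append, defect_cons_cons, ih, List.length_cons, pow_succ]
    field_simp
    ring

theorem shiftedDefect_zero (u v : List Bool) (a b : Bool) :
    shiftedDefect 0 (a :: u) (b :: v) =
      ((if a then 1 else 0) - (if b then 1 else 0) - 1 + defect u v) / 4 := by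
  rw [shiftedDefect, defect_cons_cons]
  ring

theorem shiftedDefect_succ (n : ℕ) (u v : List Bool) (a b : Bool) :
    shiftedDefect (n + 1) (a :: u) (b :: v) =
      ((if a then 1 else 0) - (if b then 1 else 0) + shiftedDefect n u v) / 4 := by
  rw [shiftedDefect, shiftedDefect, defect_cons_cons, pow_succ _ (n + 1)]
  field_simp
  ring

theorem shiftedDefect_bounds (n : ℕ) (u v : List Bool) :
    -7 / 12 ≤ shiftedDefect n u v ∧ shiftedDefect n u v ≤ 1 / 3 := by
  have h := defect_bounds u v
  -- The shift is at most 1/4, whence -7/12 = -1/3 - 1/4.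
  have h₁ : (1 : ℚ) / 4 ^ (n + 1) ≤ 1 / 4 := by
    have : (4 : ℚ) ^ 1 ≤ 4 ^ (n + 1) := pow_le_pow_right₀ (by norm_num) (by omega)
    exact one_div_le_one_div_of_le (by norm_num) (by linarith)
  have h₂ : (0 : ℚ) ≤ 1 / 4 ^ (n + 1) := by positivity
  unfold shiftedDefect
  constructor <;> linarith

/-- The digit of index `n` is a zero, so adding one to it produces no digit 2 and amounts to
changing one bit. -/
theorem shiftedDefect_replicate (n : ℕ) (u v : List Bool) :
    shiftedDefect n u (List.replicate (n + 1) false ++ v) =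
      defect u (List.replicate n false ++ true :: v) := by
  have h : ∀ n, quaternary ((List.replicate (n + 1) false ++ v).map not) =
      quaternary ((List.replicate n false ++ true :: v).map not) + 1 / 4 ^ (n + 1) := by
    intro n
    induction n with
    | zero => simp [quaternary]; ring
    | succ n ih =>
      change quaternary (true :: (List.replicate (n + 1) false ++ v).map not) =
        quaternary (true :: (List.replicate n false ++ true :: v).map not) + _
      rw [quaternary, quaternary, ih, pow_succ _ (n + 1)]
      field_simp
      ring
  rw [shiftedDefect, defect, h, defect]
  ring

/-- If `v` starts with `m ≠ n + 1` zeros and the digits `101`, and `u` with any number of zeros and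
the digits `110`, then they are far from agreeing. -/
theorem le_abs_shiftedDefect (n : ℕ) : ∀ (j m : ℕ) (u v : List Bool), m ≠ n + 1 →
    1 / (100 * 4 ^ n) ≤ |shiftedDefect n (List.replicate j false ++ true :: true :: false :: u)
      (List.replicate m false ++ true :: false :: true :: v)| := by
  have far : ∀ {x c : ℚ}, (c ≤ x ∨ c ≤ -x) → c ≤ |x| := fun h => le_abs.2 h
  induction n with
  | zero =>
    intro j m u v hm
    apply far
    obtain _ | j := j <;> obtain _ | m := m
    · have := defect_bounds (true :: false :: u) (false :: true :: v)
      simp [shiftedDefect_zero]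
      right; linarith
    · obtain _ | m := m
      -- This is m = 1, the excluded value: there `010` shifted becomes `110`, in agreement with
      -- `u`.
      · simp at hm
      have := defect_bounds (false :: u) (List.replicate m false ++ true :: false :: true :: v)
      simp [shiftedDefect_zero, List.replicate_succ, defect_cons_cons]
      left; linarith
    · have := defect_bounds (List.replicate j false ++ true :: true :: false :: u)
        (false :: true :: v)
      simp [shiftedDefect_zero, List.replicate_succ]
      right; linarith
    · have := defect_bounds (List.replicate j false ++ true :: true :: false :: u)
        (List.replicate m false ++ true :: false :: true :: v)
      simp [shiftedDefect_zero, List.replicate_succ]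
      right; linarith
  | succ n ih =>
    intro j m u v hm
    -- The constant 100 is slack; what matters is the factor 4 for each common leading zero.
    have h₀ : (1 : ℚ) / (100 * 4 ^ (n + 1)) ≤ 1 / 400 := by
      have : (4 : ℚ) ^ 1 ≤ 4 ^ (n + 1) := pow_le_pow_right₀ (by norm_num) (by omega)
      exact one_div_le_one_div_of_le (by norm_num) (by linarith)
    obtain _ | j := j <;> obtain _ | m := m
    · refine h₀.trans (far ?_)
      obtain _ | n := n
      -- Here `101` shifted becomes `111`, against `110`: only the third digit differs. This is why
      -- the block after the zeros of `v` has to be `101` and not just `10`.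
      · have := defect_bounds u v
        simp [shiftedDefect_succ, shiftedDefect_zero, defect_cons_cons]
        right; linarith
      · have := shiftedDefect_bounds n (false :: u) (true :: v)
        simp [shiftedDefect_succ _ (_ :: _ :: _) (_ :: _ :: _),
          shiftedDefect_succ _ (_ :: _) (_ :: _)]
        left; linarith
    · refine h₀.trans (far ?_)
      have := shiftedDefect_bounds n (true :: false :: u)
        (List.replicate m false ++ true :: false :: true :: v)
      simp [shiftedDefect_succ, List.replicate_succ]
      left; linarith
    · refine h₀.trans (far ?_)
      have := shiftedDefect_bounds n (List.replicate j false ++ true :: true :: false :: u)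
        (false :: true :: v)
      simp [shiftedDefect_succ, List.replicate_succ]
      right; linarith
    · have := ih j m u v (by omega)
      simp only [List.replicate_succ, List.cons_append, shiftedDefect_succ, sub_self, zero_add,
        abs_div]
      rw [pow_succ, ← mul_assoc, ← div_div]
      rw [abs_of_pos (by norm_num : (0 : ℚ) < 4)]
      exact div_le_div_of_nonneg_right this (by norm_num)

/-! ### Agreement of reading and writing: gaps and forced runs -/

namespace TapeGraph

variable {D : Type} (G : TapeGraph D)

/-- With pending queue content `q`, no path from `d` to a final node can read from the queue
approximately what was written to it. -/
def Gap (d : D) (q : List Bool) : Prop :=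
  ∃ c : ℚ, 0 < c ∧ ∀ u v e, G.Path d u v e → G.final e = true → c ≤ |defect u (q ++ v)|

variable {G}

/-- A path stops here, reads a wrong bit, or reads the front of the queue. A missing edge rules out
the last case; this is how halting produces a gap. -/
theorem gap_read {d d' : D} {b : Bool} {q : List Bool} (hd : G.reads d = true)
    (hn : G.next d b = some d' ∧ G.Gap d' q ∨ G.next d b = none) : G.Gap d (b :: q) := by
  obtain ⟨c, hc, h⟩ : ∃ c : ℚ, 0 < c ∧ ∀ d', G.next d b = some d' →
      ∀ u v e, G.Path d' u v e → G.final e = true → c ≤ |defect u (q ++ v)| := by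
    rcases hn with ⟨hn, c, hc, h⟩ | hn
    · refine ⟨c, hc, fun d'' h' => ?_⟩
      rw [hn] at h'
      cases h'
      exact h
    · exact ⟨1, one_pos, by simp [hn]⟩
  have hpos : 0 < |defect [] (b :: q)| := abs_pos.2 (defect_nil_neg _).ne
  -- In order: the gap after a correct bit, scaled by one digit; the cost (1 - 1/3)/4 of a wrong
  -- bit; the nonzero defect of stopping at once.
  refine ⟨min (c / 4) (min (1 / 6) |defect [] (b :: q)|), by positivity, ?_⟩
  intro u v e hp he
  cases hp with
  | nil => simp
  | @read _ b' d'' u v _ _ hn' hp =>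
    rw [List.cons_append, defect_cons_cons]
    by_cases hb : b' = b
    · subst hb
      refine (min_le_left _ _).trans ?_
      rw [sub_self, zero_add, abs_div, abs_of_pos (by norm_num : (0 : ℚ) < 4)]
      exact div_le_div_of_nonneg_right (h _ hn' _ _ _ hp he) (by norm_num)
    · refine (min_le_right _ _).trans ((min_le_left _ _).trans ?_)
      have := defect_bounds u (q ++ v)
      cases b' <;> cases b <;> simp at hb ⊢ <;> rw [le_abs]
      · right; linarith
      · left; linarith
  | write hd' => simp [hd] at hd'

/-- The path cannot stop here and the written bit is forced, so the bit merely joins the pending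
queue. -/
theorem gap_write {d d' : D} {b : Bool} {q : List Bool} (hd : G.reads d = false)
    (hf : G.final d = false) (hn : G.next d b = some d') (hn' : G.next d (!b) = none)
    (h : G.Gap d' (q ++ [b])) : G.Gap d q := by
  obtain ⟨c, hc, h⟩ := h
  refine ⟨c, hc, fun u v e hp he => ?_⟩
  cases hp with
  | nil => simp [hf] at he
  | read hd' => simp [hd] at hd'
  | @write _ b' d'' u v _ _ hn'' hp =>
    have hb : b' = b := by
      by_contra hb
      have : b' = !b := by cases b' <;> cases b <;> simp_all
      simp [this, hn'] at hn''
    subst hb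
    rw [hn] at hn''
    cases hn''
    simpa using h _ _ _ hp he

/-- `G.Reach r d q e q'`: with pending queue content `q`, the deterministic run from `d` leads to
`e` with queue content `q'`, and reads `r` bits. -/
inductive Reach (G : TapeGraph D) : ℕ → D → List Bool → D → List Bool → Prop
  | refl (d : D) (q : List Bool) : Reach G 0 d q d q
  | read {r d b d' q e q'} : G.reads d = true → G.next d b = some d' → Reach G r d' q e q' →
      Reach G (r + 1) d (b :: q) e q'
  | write {r d b d' q e q'} : G.reads d = false → G.final d = false → G.next d b = some d' →
      G.next d (!b) = none → Reach G r d' (q ++ [b]) e q' → Reach G r d q e q'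

theorem Reach.trans {r₁ r₂ : ℕ} {d₁ d₂ d₃ : D} {q₁ q₂ q₃ : List Bool}
    (h₁ : G.Reach r₁ d₁ q₁ d₂ q₂) (h₂ : G.Reach r₂ d₂ q₂ d₃ q₃) :
    G.Reach (r₁ + r₂) d₁ q₁ d₃ q₃ := by
  induction h₁ with
  | refl => simpa using h₂
  | @read r _ _ _ _ _ _ hd hn _ ih =>
    rw [Nat.add_right_comm]
    exact .read hd hn (ih h₂)
  | write hd hf hn hn' _ ih => exact .write hd hf hn hn' (ih h₂)

theorem Reach.gap {r : ℕ} {d e : D} {q q' : List Bool} (h : G.Reach r d q e q')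
    (he : G.Gap e q') : G.Gap d q := by
  induction h with
  | refl => exact he
  | read hd hn _ ih => exact gap_read hd (Or.inl ⟨hn, ih he⟩)
  | write hd hf hn hn' _ ih => exact gap_write hd hf hn hn' (ih he)

/-- The equation says that `u` is a prefix of `q ++ v`, so a run that reads many bits has a small
defect. -/
theorem Reach.exists_path {r : ℕ} {d e : D} {q q' : List Bool} (h : G.Reach r d q e q') :
    ∃ u v, G.Path d u v e ∧ u.length = r ∧ q ++ v = u ++ q' := by
  induction h with
  | refl d q => exact ⟨[], [], .nil d, rfl, by simp⟩
  | read hd hn _ ih =>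
    obtain ⟨u, v, hp, hr, hq⟩ := ih
    exact ⟨_, _, .read hd hn hp, by simp [hr], by simp [hq]⟩
  | write hd _ hn _ _ ih =>
    obtain ⟨u, v, hp, hr, hq⟩ := ih
    exact ⟨_, _, .write hd hn hp, hr, by simpa using hq⟩

end TapeGraph

/-! ### Queue machines as tape graphs -/

/-- A deterministic queue machine with control states `C` and queue alphabet `S`: reading a symbol,
it changes its control state and appends symbols to the queue. -/
structure QueueMachine (C S : Type) where
  step : C → S → Option (C × List S)
  /-- The symbol of the unary input. -/
  unit : S
  /-- What follows the units in the initial queue. -/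
  tail : List S
  start : C

namespace QueueMachine

/-- `M.Reach r c q c' q'`: in `r` steps `M` gets from control state `c` and queue content `q` to
control state `c'` and queue content `q'`. -/
inductive Reach {C S : Type} (M : QueueMachine C S) : ℕ → C → List S → C → List S → Prop
  | refl (c : C) (q : List S) : Reach M 0 c q c q
  | step {r c x q c₁ ys c' q'} : M.step c x = some (c₁, ys) → Reach M r c₁ (q ++ ys) c' q' →
      Reach M (r + 1) c (x :: q) c' q'

variable {C S : Type}

theorem Reach.trans {M : QueueMachine C S} {r₁ r₂ : ℕ} {c₁ c₂ c₃ : C} {q₁ q₂ q₃ : List S}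
    (h₁ : M.Reach r₁ c₁ q₁ c₂ q₂) (h₂ : M.Reach r₂ c₂ q₂ c₃ q₃) :
    M.Reach (r₁ + r₂) c₁ q₁ c₃ q₃ := by
  induction h₁ with
  | refl => simpa using h₂
  | @step r _ _ _ _ _ _ _ hs _ ih =>
    rw [Nat.add_right_comm]
    exact .step hs (ih h₂)

/-- The input `n` as the initial queue content. -/
def input (M : QueueMachine C S) (n : ℕ) : List S := List.replicate n M.unit ++ M.tail

/-- Nodes of the tape graph of a queue machine. -/
inductive Node (C : Type)
  | fill | fillEnd | scan | scanEnd | scanOk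
  | rd (c : C) (i : ℕ)
  | wr (c : Option C) (b : Bool) (bs : List Bool)

open Node

variable [Fintype S]

/-- The code word of a symbol. -/
noncomputable def code (x : S) : List Bool :=
  List.replicate ((Fintype.equivFin S x : ℕ) + 1) true ++ [false]

/-- The code of a queue content. -/
noncomputable def codes (q : List S) : List Bool := q.flatMap code

/-- The node in which `bs` is about to be written before going to `c`. -/
def write : Option C → List Bool → Node C
  | none, [] => scan
  | some c, [] => rd c 0
  | c, b :: bs => wr c b bs

open Classical in
/-- The tape graph of a queue machine. It first writes an arbitrary number of zeros and `10`, then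
reads zeros and `110`, writing a code word for every zero, and then simulates the machine. -/
noncomputable def graph (M : QueueMachine C S) : TapeGraph (Node C) where
  reads
    | fill => false
    | fillEnd => false
    | wr _ _ _ => false
    | _ => true
  next
    | fill, false => some fill
    | fill, true => some fillEnd
    | fillEnd, false => some scan
    | scan, false => some (write none (code M.unit))
    | scan, true => some scanEnd
    | scanEnd, true => some scanOk
    | scanOk, false => some (write (some M.start) (codes M.tail))
    | rd c i, true => if i < Fintype.card S then some (rd c (i + 1)) else none
    | rd c (i + 1), false =>
        if h : i < Fintype.card S then
          (M.step c ((Fintype.equivFin S).symm ⟨i, h⟩)).map fun p => write (some p.1) (codes p.2)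
        else none
    | wr c b bs, b' => if b' = b then some (write c bs) else none
    | _, _ => none
  final
    -- A path may stop between any two symbols, so every finite part of a run gives a word, and
    -- longer parts give better approximations.
    | rd _ 0 => true
    | _ => false

variable (M : QueueMachine C S)

theorem reach_write (c : Option C) (bs q : List Bool) :
    M.graph.Reach 0 (write c bs) q (write c []) (q ++ bs) := by
  induction bs generalizing q with
  | nil => simpa using TapeGraph.Reach.refl (G := M.graph) (write c []) q
  | cons b bs ih =>
    have h := ih (q ++ [b])
    rw [List.append_assoc, List.singleton_append] at h
    cases c <;> exact .write (b := b) (d' := write _ bs) rfl rfl (by simp [graph, write])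
      (by simp [graph, write]) h

theorem reach_read (c : C) (q : List Bool) (k i : ℕ) (h : i + k ≤ Fintype.card S) :
    M.graph.Reach k (rd c i) (List.replicate k true ++ q) (rd c (i + k)) q := by
  induction k generalizing i with
  | zero => exact .refl _ _
  | succ k ih =>
    have h' := ih (i + 1) (by omega)
    rw [Nat.add_right_comm] at h'
    exact .read rfl (by simp [graph]; omega) h'

theorem reach_step {c c' : C} {x : S} {ys : List S} (h : M.step c x = some (c', ys))
    (q : List Bool) : ∃ r, 1 ≤ r ∧
      M.graph.Reach r (rd c 0) (code x ++ q) (rd c' 0) (q ++ codes ys) := by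
  have h₁ := M.reach_read c (false :: q) ((Fintype.equivFin S x : ℕ) + 1) 0 (by omega)
  have h₂ : M.graph.Reach 1 (rd c ((Fintype.equivFin S x : ℕ) + 1)) (false :: q) (rd c' 0)
      (q ++ codes ys) :=
    .read rfl (by simp [graph, h]) (M.reach_write (some c') (codes ys) q)
  rw [Nat.zero_add] at h₁
  refine ⟨(Fintype.equivFin S x : ℕ) + 1 + 1, by omega, ?_⟩
  simpa [code] using h₁.trans h₂

/-- The edge for the final zero of the code word of `x` is missing. -/
theorem gap_of_step_eq_none {c : C} {x : S} (h : M.step c x = none) (q : List Bool) :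
    M.graph.Gap (rd c 0) (code x ++ q) := by
  have h₁ := M.reach_read c (false :: q) ((Fintype.equivFin S x : ℕ) + 1) 0 (by omega)
  rw [Nat.zero_add] at h₁
  have := h₁.gap (TapeGraph.gap_read (d' := scan) rfl (Or.inr (by simp [graph, h])))
  simpa [code] using this

/-- The bound `r ≤ r'` makes an infinite run of the machine read unboundedly many bits. -/
theorem reach_graph {r : ℕ} {c c' : C} {q q' : List S} (h : M.Reach r c q c' q') :
    ∃ r', r ≤ r' ∧ M.graph.Reach r' (rd c 0) (codes q) (rd c' 0) (codes q') := by
  induction h with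
  | refl c q => exact ⟨0, le_rfl, .refl _ _⟩
  | @step r c x q c₁ ys c' q' hs _ ih =>
    obtain ⟨r₁, h₁, hr₁⟩ := M.reach_step hs (codes q)
    obtain ⟨r₂, h₂, hr₂⟩ := ih
    refine ⟨r₁ + r₂, by omega, ?_⟩
    have e₁ : codes (x :: q) = code x ++ codes q := by simp [codes]
    have e₂ : codes (q ++ ys) = codes q ++ codes ys := by simp [codes]
    rw [e₁]
    rw [e₂] at hr₂
    exact hr₁.trans hr₂

theorem reach_scan (n : ℕ) : ∃ r, M.graph.Reach r scan
    (List.replicate n false ++ [true, true, false]) (rd M.start 0) (codes (M.input n)) := by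
  have key : ∀ n q, M.graph.Reach n scan (List.replicate n false ++ q) scan
      (q ++ codes (List.replicate n M.unit)) := by
    intro n
    induction n with
    | zero => intro q; simpa [codes] using TapeGraph.Reach.refl (G := M.graph) scan q
    | succ n ih =>
      intro q
      refine .read (d' := write none (code M.unit)) rfl rfl ?_
      have h := (M.reach_write none (code M.unit) (List.replicate n false ++ q)).trans
        (by rw [List.append_assoc]; exact ih (q ++ code M.unit))
      simpa [codes, List.replicate_succ] using h
  have h₁ := key n [true, true, false]
  have h₂ : M.graph.Reach 3 scan ([true, true, false] ++ codes (List.replicate n M.unit))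
      (rd M.start 0) (codes (M.input n)) := by
    refine .read (d' := scanEnd) rfl rfl (.read (d' := scanOk) rfl rfl
      (.read (d' := write (some M.start) (codes M.tail)) rfl rfl ?_))
    simpa [input, codes, write] using
      M.reach_write (some M.start) (codes M.tail) (codes (List.replicate n M.unit))
  exact ⟨_, h₁.trans h₂⟩

theorem path_fill (m : ℕ) {u v : List Bool} {e : Node C} (h : M.graph.Path scan u v e) :
    M.graph.Path fill u (List.replicate m false ++ true :: false :: v) e := by
  induction m with
  | zero => exact .write (d' := fillEnd) rfl rfl (.write (d' := scan) rfl rfl h)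
  | succ m ih => exact .write (d' := fill) rfl rfl ih

variable {M}

theorem path_fill_inv {u v : List Bool} {e : Node C} (h : M.graph.Path fill u v e)
    (he : M.graph.final e = true) : ∃ m w, v = List.replicate m false ++ true :: false :: w ∧
      M.graph.Path scan u w e := by
  generalize hd : (fill : Node C) = d at h
  induction h with
  | nil d => subst hd; simp [graph] at he
  | read hr => subst hd; simp [graph] at hr
  | @write d b d' u v e hr hn hp ih =>
    subst hd
    cases b with
    | false =>
      simp [graph] at hn
      obtain ⟨m, w, rfl, hw⟩ := ih he hn
      exact ⟨m + 1, w, rfl, hw⟩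
    | true =>
      simp [graph] at hn
      subst hn
      cases hp with
      | nil => simp [graph] at he
      | read hr => simp [graph] at hr
      | @write _ b d' u v _ hr hn hp =>
        cases b <;> simp [graph] at hn
        subst hn
        exact ⟨0, v, rfl, hp⟩

theorem path_write_inv {c : Option C} {bs u v : List Bool} {e : Node C}
    (h : M.graph.Path (write c bs) u v e) (he : M.graph.final e = true) :
    ∃ w, v = bs ++ w ∧ M.graph.Path (write c []) u w e := by
  induction bs generalizing v with
  | nil => exact ⟨v, rfl, h⟩
  | cons b bs ih =>
    have : (write c (b :: bs) : Node C) = wr c b bs := by cases c <;> rfl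
    rw [this] at h
    cases h with
    | nil => simp [graph] at he
    | read hr => simp [graph] at hr
    | @write _ b' d' u v _ hr hn hp =>
      simp only [graph, Option.ite_none_right_eq_some, Option.some.injEq] at hn
      obtain ⟨rfl, rfl⟩ := hn
      obtain ⟨w, rfl, hw⟩ := ih hp
      exact ⟨w, rfl, hw⟩

/-- A final node is reached only after `110` has been read. Code words begin with a one and `M.tail`
is nonempty, so the first bit written from `scan` on is a one; it completes the `10` written before
to the block `101`. -/
theorem path_scan_inv (hM : M.tail ≠ []) {u v : List Bool} {e : Node C}
    (h : M.graph.Path scan u v e)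
    (he : M.graph.final e = true) : ∃ j u' v',
      u = List.replicate j false ++ true :: true :: false :: u' ∧ v = true :: v' := by
  have hc : ∀ x : S, ∃ bs, code x = true :: bs := fun x => ⟨_, rfl⟩
  induction hl : u.length generalizing u v with
  | zero =>
    cases h with
    | nil => simp [graph] at he
    | read => simp at hl
    | write hr => simp [graph] at hr
  | succ k ih =>
    cases h with
    | nil => simp at hl
    | write hr => simp [graph] at hr
    | @read _ b d' u v _ hr hn hp =>
      cases b with
      | false =>
        simp [graph] at hn
        subst hn
        obtain ⟨w, rfl, hw⟩ := path_write_inv hp he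
        obtain ⟨j, u', v', rfl, rfl⟩ := ih hw (by simpa using hl)
        obtain ⟨bs, hbs⟩ := hc M.unit
        exact ⟨j + 1, u', _, rfl, by rw [hbs]; rfl⟩
      | true =>
        simp [graph] at hn
        subst hn
        cases hp with
        | nil => simp [graph] at he
        | write hr => simp [graph] at hr
        | @read _ b d' u v _ hr hn hp =>
          cases b <;> simp [graph] at hn
          subst hn
          cases hp with
          | nil => simp [graph] at he
          | write hr => simp [graph] at hr
          | @read _ b d' u v _ hr hn hp =>
            cases b <;> simp [graph] at hn
            subst hn
            obtain ⟨w, rfl, hw⟩ := path_write_inv hp he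
            obtain ⟨x, t, ht⟩ := List.exists_cons_of_ne_nil hM
            obtain ⟨bs, hbs⟩ := hc x
            exact ⟨0, u, _, rfl, by rw [ht, codes, List.flatMap_cons, hbs]; rfl⟩

/-- If the machine halts on input `n`, then the paths of its tape graph stay away from the number
`4 ^ -(n + 1)`. -/
theorem exists_le_abs_shiftedDefect (hM : M.tail ≠ []) {n r : ℕ} {c : C} {x : S} {q : List S}
    (h : M.Reach r M.start (M.input n) c (x :: q)) (hs : M.step c x = none) :
    ∃ ε : ℚ, 0 < ε ∧ ∀ u v e, M.graph.Path fill u v e → M.graph.final e = true →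
      ε ≤ |shiftedDefect n u v| := by
  obtain ⟨r₁, h₁⟩ := M.reach_scan n
  obtain ⟨r₂, -, h₂⟩ := M.reach_graph h
  have hg : M.graph.Gap (rd c 0) (codes (x :: q)) := by
    simpa [codes] using M.gap_of_step_eq_none hs (codes q)
  obtain ⟨ε, hε, H⟩ := (h₁.trans h₂).gap hg
  refine ⟨min ε (1 / (100 * 4 ^ n)), by positivity, fun u v e hp he => ?_⟩
  obtain ⟨m, w, rfl, hw⟩ := path_fill_inv hp he
  -- For the right guess the shift turns n + 1 zeros and `10` into n zeros and `110`, which `scan`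
  -- decodes as the input n. A wrong guess is far off for any continuation.
  by_cases hm : m = n + 1
  · subst hm
    refine (min_le_left _ _).trans ?_
    rw [shiftedDefect_replicate]
    simpa using H u w e hw he
  · refine (min_le_right _ _).trans ?_
    obtain ⟨j, u', v', rfl, rfl⟩ := path_scan_inv hM hw he
    exact le_abs_shiftedDefect n j m u' v' hm

/-- If the machine runs forever on input `n`, then the paths of its tape graph come arbitrarily
close to the number `4 ^ -(n + 1)`. -/
theorem exists_abs_shiftedDefect_lt {n : ℕ}
    (h : ∀ N, ∃ r c q, N ≤ r ∧ M.Reach r M.start (M.input n) c q) {ε : ℚ} (hε : 0 < ε) :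
    ∃ u v e, M.graph.Path fill u v e ∧ M.graph.final e = true ∧ |shiftedDefect n u v| < ε := by
  obtain ⟨N, hN⟩ := exists_pow_lt_of_lt_one hε (by norm_num : (1 / 4 : ℚ) < 1)
  obtain ⟨r, c, q, hr, hc⟩ := h N
  obtain ⟨r₁, h₁⟩ := M.reach_scan n
  obtain ⟨r₂, hr₂, h₂⟩ := M.reach_graph hc
  obtain ⟨u, v, hp, hu, hq⟩ := (h₁.trans h₂).exists_path
  refine ⟨u, _, _, M.path_fill (n + 1) hp, rfl, ?_⟩
  rw [shiftedDefect_replicate]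
  have e₁ : List.replicate n false ++ true :: true :: false :: v = u ++ codes q := by
    simpa using hq
  rw [e₁]
  have h₃ := defect_append_append u [] (codes q)
  rw [List.append_nil] at h₃
  have h₄ := defect_bounds [] (codes q)
  have h₅ : |defect [] (codes q)| < 1 := abs_lt.2 ⟨by linarith, by linarith⟩
  rw [h₃, abs_div, abs_of_pos (by positivity : (0 : ℚ) < 4 ^ u.length)]
  refine lt_of_le_of_lt ?_ hN
  rw [one_div, inv_pow, div_eq_mul_inv]
  have h₆ : ((4 : ℚ) ^ u.length)⁻¹ ≤ (4 ^ N)⁻¹ :=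
    inv_anti₀ (by positivity) (pow_le_pow_right₀ (by norm_num) (by omega))
  have h₇ : (0 : ℚ) < (4 ^ u.length)⁻¹ := by positivity
  nlinarith

end QueueMachine

/-! ### Restriction to finitely many nodes and renaming of states -/

namespace TapeGraph

variable {D : Type}

open Classical in
/-- The part of a tape graph on a set of nodes. -/
noncomputable def restrict (G : TapeGraph D) (T : Set D) : TapeGraph T where
  reads d := G.reads d
  next d b := (G.next d b).bind fun d' => if h : d' ∈ T then some ⟨d', h⟩ else none
  final d := G.final d

variable {G : TapeGraph D} {T : Set D}

theorem next_restrict {d d' : T} {b : Bool} :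
    (G.restrict T).next d b = some d' ↔ G.next d b = some (d' : D) := by
  simp only [restrict, Option.bind_eq_some_iff]
  constructor
  · rintro ⟨d'', h, h'⟩
    split_ifs at h' with hT
    cases h'
    exact h
  · exact fun h => ⟨d', h, by simp⟩

theorem Path.of_restrict {d e : T} {u v : List Bool} (h : (G.restrict T).Path d u v e) :
    G.Path d u v e := by
  induction h with
  | nil d => exact .nil _
  | read hd hn _ ih => exact .read hd (next_restrict.1 hn) ih
  | write hd hn _ ih => exact .write hd (next_restrict.1 hn) ih

theorem Path.restrict (hT : ∀ d ∈ T, ∀ b d', G.next d b = some d' → d' ∈ T) {d e : D}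
    {u v : List Bool} (h : G.Path d u v e) (hd : d ∈ T) :
    ∃ he : e ∈ T, (G.restrict T).Path ⟨d, hd⟩ u v ⟨e, he⟩ := by
  induction h with
  | nil d => exact ⟨hd, .nil _⟩
  | read hr hn _ ih =>
    obtain ⟨he, hp⟩ := ih (hT _ hd _ _ hn)
    exact ⟨he, .read hr (next_restrict.2 hn) hp⟩
  | write hr hn _ ih =>
    obtain ⟨he, hp⟩ := ih (hT _ hd _ _ hn)
    exact ⟨he, .write hr (next_restrict.2 hn) hp⟩

end TapeGraph

namespace ProbAutomaton

variable {Q A : Type} [Fintype Q]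

/-- The same automaton with renamed states and letters. -/
def reindex (𝒜 : ProbAutomaton Q A) {Q' A' : Type} [Fintype Q'] (e : Q ≃ Q') (f : A ≃ A') :
    ProbAutomaton Q' A' where
  trans a := (𝒜.trans (f.symm a)).submatrix e.symm e.symm
  trans_nonneg a s t := 𝒜.trans_nonneg _ _ _
  trans_sum a s := by
    rw [← 𝒜.trans_sum (f.symm a) (e.symm s)]
    exact e.symm.sum_comp fun t => 𝒜.trans (f.symm a) (e.symm s) t
  init := e 𝒜.init
  accept := 𝒜.accept.map e.toEmbedding

variable (𝒜 : ProbAutomaton Q A) {Q' A' : Type} [Fintype Q'] (e : Q ≃ Q') (f : A ≃ A')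

theorem value_reindex (φ : Q' → ℚ) (w : List A') (s : Q') :
    (𝒜.reindex e f).value φ w s = 𝒜.value (φ ∘ e) (w.map f.symm) (e.symm s) := by
  induction w generalizing s with
  | nil => simp [value]
  | cons a w ih =>
    simp only [value, List.map_cons, ih]
    exact e.symm.sum_comp fun t => 𝒜.trans (f.symm a) (e.symm s) t *
      𝒜.value (φ ∘ e) (w.map f.symm) t

theorem acceptProb_reindex [DecidableEq Q] [DecidableEq Q'] (w : List A') :
    (𝒜.reindex e f).acceptProb w = 𝒜.acceptProb (w.map f.symm) := by
  rw [acceptProb_eq_value, acceptProb_eq_value, value_reindex]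
  simp [reindex, Function.comp_def]

theorem hasWordsNear_reindex [DecidableEq Q] [DecidableEq Q'] (lam : ℚ) :
    (𝒜.reindex e f).HasWordsNear lam ↔ 𝒜.HasWordsNear lam := by
  refine forall₂_congr fun ε _ => ⟨?_, ?_⟩
  · rintro ⟨w, hw⟩
    exact ⟨w.map f.symm, by rwa [← acceptProb_reindex 𝒜 e f]⟩
  · rintro ⟨w, hw⟩
    refine ⟨w.map f, ?_⟩
    rwa [acceptProb_reindex, List.map_map, Equiv.symm_comp_self, List.map_id]

variable {𝒜}

theorem IsSimple.reindex (h : 𝒜.IsSimple) : (𝒜.reindex e f).IsSimple :=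
  fun a s t => h (f.symm a) (e.symm s) (e.symm t)

theorem HasOneProbTransition.reindex (h : 𝒜.HasOneProbTransition) :
    (𝒜.reindex e f).HasOneProbTransition := by
  have key : ∀ p : Q' × A', (𝒜.reindex e f).IsProbTransition p ↔
      𝒜.IsProbTransition ((e.prodCongr f).symm p) := by
    intro p
    exact ⟨fun ⟨t, ht⟩ => ⟨e.symm t, ht⟩, fun ⟨t, ht⟩ => ⟨e t, by
      simpa [ProbAutomaton.reindex] using ht⟩⟩
  obtain ⟨p, hp, hu⟩ := h
  refine ⟨e.prodCongr f p, (key _).2 (by rwa [Equiv.symm_apply_apply]), fun p' hp' => ?_⟩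
  rw [← Equiv.symm_apply_eq]
  exact hu _ ((key p').1 hp')

end ProbAutomaton

/-! ### From queue machines to simple automata -/

namespace QueueMachine

open Node

variable {C S : Type} [Fintype S] (M : QueueMachine C S)

/-- The nodes carry a counter and a list, but reachable counters are at most the size of the
alphabet, and the lists are bounded by the longest output of a step, there being finitely many pairs
of control state and symbol. -/
theorem exists_finite_closed {K : Set C} (hK : K.Finite) (hs : M.start ∈ K)
    (hc : ∀ c ∈ K, ∀ x c' ys, M.step c x = some (c', ys) → c' ∈ K) :
    ∃ T : Set (Node C), T.Finite ∧ fill ∈ T ∧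
      ∀ d ∈ T, ∀ b d', M.graph.next d b = some d' → d' ∈ T := by
  obtain ⟨L, hL⟩ : ∃ L, ∀ c ∈ K, ∀ x p, M.step c x = some p → (codes p.2).length ≤ L := by
    obtain ⟨L, hL⟩ := ((hK.prod (Set.finite_univ (α := S))).image fun p : C × S =>
      (M.step p.1 p.2).elim 0 fun p => (codes p.2).length).bddAbove
    refine ⟨L, fun c hc x p hp => hL ⟨(c, x), ⟨hc, trivial⟩, by simp [hp]⟩⟩
  set L' := L + (code M.unit).length + (codes M.tail).length with hL'
  set O : Set (Option C) := insert none (some '' K) with hO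
  set T : Set (Node C) := {fill, fillEnd, scan, scanEnd, scanOk} ∪
    (Set.image2 rd K (Set.Iic (Fintype.card S)) ∪
      (fun p : Option C × Bool × List Bool => wr p.1 p.2.1 p.2.2) ''
        (O ×ˢ (Set.univ : Set Bool) ×ˢ {bs | bs.length ≤ L'})) with hT
  have hw : ∀ c bs, c ∈ O → bs.length ≤ L' → write c bs ∈ T := by
    intro c bs hc hbs
    obtain _ | ⟨b, bs⟩ := bs
    · rcases hc with rfl | ⟨c, hc, rfl⟩
      · simp [write, hT]
      · exact Or.inr (Or.inl ⟨c, hc, 0, by simp, rfl⟩)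
    · have : (write c (b :: bs) : Node C) = wr c b bs := by cases c <;> rfl
      rw [this]
      exact Or.inr (Or.inr ⟨(c, b, bs), ⟨hc, trivial, by simp at hbs ⊢; omega⟩, rfl⟩)
  refine ⟨T, ?_, by simp [hT], ?_⟩
  · refine (Set.toFinite _).union ((hK.image2 rd (Set.finite_Iic _)).union (Set.Finite.image _ ?_))
    exact ((hK.image _).insert _).prod (Set.finite_univ.prod (List.finite_length_le Bool L'))
  · rintro d (hd | ⟨c, hcK, i, hi, rfl⟩ | ⟨⟨c, b', bs⟩, ⟨hcO, -, hbs⟩, rfl⟩) b d' hn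
    · simp only [Set.mem_insert_iff, Set.mem_singleton_iff] at hd
      rcases hd with rfl | rfl | rfl | rfl | rfl <;> cases b <;>
        simp only [graph, Option.some.injEq, reduceCtorEq] at hn <;> subst hn
      · simp [hT]
      · simp [hT]
      · simp [hT]
      · exact hw _ _ (by simp [hO]) (by omega)
      · simp [hT]
      · simp [hT]
      · exact hw _ _ (by simp [hO, hs]) (by omega)
    · cases b with
      | true =>
        simp only [graph, Option.ite_none_right_eq_some, Option.some.injEq] at hn
        obtain ⟨hi', rfl⟩ := hn
        exact Or.inr (Or.inl ⟨c, hcK, i + 1, hi', rfl⟩)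
      | false =>
        obtain _ | i := i
        · simp [graph] at hn
        simp only [graph] at hn
        split_ifs at hn with hi'
        obtain ⟨p, hp, rfl⟩ := Option.map_eq_some_iff.1 hn
        have h₁ := hL _ hcK _ _ hp
        exact hw _ _ (by simp [hO, hc _ hcK _ _ _ hp]) (by omega)
    · simp only [graph, Option.ite_none_right_eq_some, Option.some.injEq] at hn
      obtain ⟨-, rfl⟩ := hn
      exact hw _ _ hcO hbs

/-- The machine halts on input `n`. -/
def Halts (n : ℕ) : Prop :=
  ∃ r c x q, M.Reach r M.start (M.input n) c (x :: q) ∧ M.step c x = none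

/-- The machine runs forever on input `n`. -/
def Diverges (n : ℕ) : Prop := ∀ N, ∃ r c q, N ≤ r ∧ M.Reach r M.start (M.input n) c q

/-- The number whose isolation tells whether a machine halts on input `n`. -/
def threshold (n : ℕ) : ℚ := 1 / 2 + (1 / 3 + 1 / 4 ^ (n + 1)) / 8

theorem exists_automaton (hM : M.tail ≠ []) {K : Set C} (hK : K.Finite) (hs : M.start ∈ K)
    (hc : ∀ c ∈ K, ∀ x c' ys, M.step c x = some (c', ys) → c' ∈ K) :
    ∃ (n k : ℕ) (𝒜 : ProbAutomaton (Fin n) (Fin k)), 𝒜.IsSimple ∧ 𝒜.HasOneProbTransition ∧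
      ∀ i, (M.Halts i → ¬ 𝒜.HasWordsNear (threshold i)) ∧
        (M.Diverges i → 𝒜.HasWordsNear (threshold i)) := by
  classical
  obtain ⟨T, hT, hd, hcl⟩ := M.exists_finite_closed hK hs hc
  have := hT.fintype
  set G := M.graph.restrict T with hG
  set d₀ : T := ⟨fill, hd⟩ with hd₀
  let e := Fintype.equivFin (TapeGraph.State T)
  let f := Fintype.equivFin (TapeGraph.Letter T)
  refine ⟨_, _, (G.automaton d₀).reindex e f, (G.isSimple_automaton d₀).reindex e f,
    (G.hasOneProbTransition_automaton d₀).reindex e f, fun i => ?_⟩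
  rw [ProbAutomaton.hasWordsNear_reindex]
  have hdiff : ∀ u v, 1 / 2 + (quaternary u + quaternary (v.map not)) / 8 - threshold i =
      shiftedDefect i u v / 8 := by
    intro u v
    rw [threshold, shiftedDefect, defect]
    ring
  have h8 : |(8 : ℚ)| = 8 := abs_of_pos (by norm_num)
  constructor
  · rintro ⟨r, c, x, q, hr, hx⟩ hnear
    obtain ⟨ε, hε, H⟩ := exists_le_abs_shiftedDefect hM hr hx
    -- The threshold exceeds 1/2 by more than 1/24, which excludes the words accepted with
    -- probability at most 1/2; on the others, a defect enters the probability divided by 8.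
    obtain ⟨w, hw⟩ := hnear (min (ε / 8) (1 / 24)) (by positivity)
    rcases G.acceptProb_le_half_or d₀ w with h | ⟨u, v, e, hp, he, h⟩
    · have h₁ := (abs_lt.1 (hw.trans_le (min_le_right _ _))).1
      have h₂ : (0 : ℚ) < 1 / 4 ^ (i + 1) := by positivity
      rw [threshold] at h₁
      linarith
    · have h₁ := hw.trans_le (min_le_left _ _)
      have h₂ := H u v e hp.of_restrict he
      rw [h, hdiff, abs_div, h8] at h₁
      linarith
  · intro hdiv ε hε
    obtain ⟨u, v, e, hp, he, h⟩ :=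
      exists_abs_shiftedDefect_lt hdiv (by positivity : (0 : ℚ) < 8 * ε)
    obtain ⟨heT, hp'⟩ := hp.restrict hcl hd
    obtain ⟨w, hw⟩ := G.exists_acceptProb_eq d₀ hp' he
    refine ⟨w, ?_⟩
    rw [hw, hdiff, abs_div, h8]
    linarith

end QueueMachine

/-! ### Simulating four stacks by a queue -/

namespace StackQueue

open Turing TM2.Stmt QueueMachine
open Turing.PartrecToTM2 (K' Γ')

/-- Statements of the machines with four stacks. -/
abbrev Stmt (Γ Λ σ : Type) : Type := TM2.Stmt (fun _ : K' => Γ) Λ σ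

/-- Control states of the queue machine that simulates a machine with four stacks. The queue holds
the stacks, each preceded by the separator `none`. One pass through the queue executes one
statement. In `todo k q v` and `done k q v` the stack `k` is being copied, where `q` is the statement
of the present or of the next pass, respectively; in `look k q v` the top of `k` is read next. -/
inductive Control (Γ Λ σ : Type)
  | todo (k : K') (q : Stmt Γ Λ σ) (v : σ)
  | look (k : K') (q : Stmt Γ Λ σ) (v : σ)
  | done (k : K') (q : Stmt Γ Λ σ) (v : σ)

open Control

variable {Γ Λ σ : Type}

/-- The stacks in their order in the queue. -/
def nextStack : K' → Option K'
  | K'.main => some K'.rev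
  | K'.rev => some K'.aux
  | K'.aux => some K'.stack
  | K'.stack => none

/-- The transition on the separator that precedes the stack `j`, when `q` has to be executed. -/
def enter (M : Λ → Stmt Γ Λ σ) (j : K') (v : σ) :
    Stmt Γ Λ σ → Option (Control Γ Λ σ × List (Option Γ))
  | push k f q =>
      if j = k then some (done j q v, [none, some (f v)]) else some (todo j (push k f q) v, [none])
  | peek k f q =>
      if j = k then some (look j (peek k f q) v, [none]) else some (todo j (peek k f q) v, [none])
  | pop k f q =>
      if j = k then some (look j (pop k f q) v, [none]) else some (todo j (pop k f q) v, [none])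
  | load a q => some (done j q (a v), [none])
  | branch f q₁ q₂ => some (done j (cond (f v) q₁ q₂) v, [none])
  | goto l => some (done j (M (l v)) v, [none])
  | halt => none

/-- The transition on a separator after the current statement has been executed. -/
def advance (M : Λ → Stmt Γ Λ σ) (k : K') (q : Stmt Γ Λ σ) (v : σ) :
    Option (Control Γ Λ σ × List (Option Γ)) :=
  match nextStack k with
  | some k' => some (done k' q v, [none])
  | none => enter M K'.main v q

/-- The transition function of the queue machine that simulates a machine with four stacks. -/
def step (M : Λ → Stmt Γ Λ σ) :
    Control Γ Λ σ → Option Γ → Option (Control Γ Λ σ × List (Option Γ))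
  | done k q v, some x => some (done k q v, [some x])
  | done k q v, none => advance M k q v
  | todo k q v, some x => some (todo k q v, [some x])
  | todo k q v, none => (nextStack k).bind fun k' => enter M k' v q
  | look k (peek _ f q) v, some x => some (done k q (f v (some x)), [some x])
  | look k (pop _ f q) v, some x => some (done k q (f v (some x)), [])
  | look k (peek _ f q) v, none => advance M k q (f v none)
  | look k (pop _ f q) v, none => advance M k q (f v none)
  | look _ _ _, _ => none

/-- The queue machine that simulates a machine with four stacks over the alphabet `Γ'`, started on
`bit0 ⋯ bit0 bit1 cons` in the stack `main`. -/
def machine (M : Λ → Stmt Γ' Λ σ) (l : Λ) (v : σ) : QueueMachine (Control Γ' Λ σ) (Option Γ') where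
  step := step M
  unit := some Γ'.bit0
  tail := [some Γ'.bit1, some Γ'.cons, none, none, none, none]
  start := done K'.main (M l) v

/-- The part of the queue that holds one stack. -/
def segment (l : List Γ) : List (Option Γ) := none :: l.map some

/-- The queue content for given stacks. -/
def content (S : K' → List Γ) : List (Option Γ) :=
  segment (S K'.main) ++ (segment (S K'.rev) ++ (segment (S K'.aux) ++ segment (S K'.stack)))

section reach

variable {N : QueueMachine (Control Γ Λ σ) (Option Γ)} {M : Λ → Stmt Γ Λ σ} (hN : N.step = step M)

include hN

theorem reach_copy {c : Control Γ Λ σ} (hc : ∀ x, step M c (some x) = some (c, [some x]))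
    (l : List Γ) (Q : List (Option Γ)) :
    N.Reach l.length c (l.map some ++ Q) c (Q ++ l.map some) := by
  induction l generalizing Q with
  | nil => simpa using Reach.refl c Q
  | cons x l ih =>
    refine .step (by rw [hN, hc]) ?_
    simpa using ih (Q ++ [some x])

theorem reach_segment {c c₁ : Control Γ Λ σ} {ys : List (Option Γ)}
    (h : step M c none = some (c₁, ys)) (hc : ∀ x, step M c₁ (some x) = some (c₁, [some x]))
    (l : List Γ) (Q : List (Option Γ)) :
    ∃ r, 1 ≤ r ∧ N.Reach r c (segment l ++ Q) c₁ (Q ++ (ys ++ l.map some)) := by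
  refine ⟨l.length + 1, by omega, .step (by rw [hN, h]) ?_⟩
  simpa using reach_copy hN hc l (Q ++ ys)

theorem reach_done {c : Control Γ Λ σ} {k k' : K'} {q : Stmt Γ Λ σ} {v : σ}
    (hk : nextStack k = some k') (h : step M c none = advance M k q v) (l : List Γ)
    (Q : List (Option Γ)) :
    ∃ r, 1 ≤ r ∧ N.Reach r c (segment l ++ Q) (done k' q v) (Q ++ segment l) := by
  have h' : step M c none = some (done k' q v, [none]) := by rw [h, advance, hk]
  exact reach_segment hN h' (fun _ => rfl) l Q

theorem reach_done_done (q : Stmt Γ Λ σ) (v : σ) {k k' : K'} (hk : nextStack k = some k')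
    (l : List Γ) (Q : List (Option Γ)) :
    ∃ r, 1 ≤ r ∧ N.Reach r (done k q v) (segment l ++ Q) (done k' q v) (Q ++ segment l) :=
  reach_done hN (c := done k q v) hk rfl l Q

theorem reach_todo {c : Control Γ Λ σ} {k : K'} {q : Stmt Γ Λ σ} {v : σ}
    (h : step M c none = enter M k v q) (hk : enter M k v q = some (todo k q v, [none]))
    (l : List Γ) (Q : List (Option Γ)) :
    ∃ r, 1 ≤ r ∧ N.Reach r c (segment l ++ Q) (todo k q v) (Q ++ segment l) :=
  reach_segment hN (h.trans hk) (fun _ => rfl) l Q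

/-- A pass that changes the stack `k` from `l` to `l'`. -/
theorem reach_pass {q q' : Stmt Γ Λ σ} {v v' : σ} {k : K'} {S : K' → List Γ} {l' : List Γ}
    (htodo : ∀ j, j ≠ k → enter M j v q = some (todo j q v, [none]))
    (hop : ∀ c Q, step M c none = enter M k v q → ∃ r c₁, 1 ≤ r ∧
      step M c₁ none = advance M k q' v' ∧ N.Reach r c (segment (S k) ++ Q) c₁ (Q ++ segment l'))
    {c : Control Γ Λ σ} (hc : step M c none = enter M K'.main v q) :
    ∃ r c₁, 1 ≤ r ∧ step M c₁ none = enter M K'.main v' q' ∧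
      N.Reach r c (content S) c₁ (content (Function.update S k l')) := by
  cases k with
  | main =>
    obtain ⟨r₁, c₁, h₁, e₁, R₁⟩ := hop c (segment (S K'.rev) ++ (segment (S K'.aux) ++
      segment (S K'.stack))) hc
    obtain ⟨r₂, -, R₂⟩ := reach_done hN rfl e₁ (S K'.rev)
      (segment (S K'.aux) ++ (segment (S K'.stack) ++ segment l'))
    obtain ⟨r₃, -, R₃⟩ := reach_done_done hN q' v' (k := K'.rev) rfl
      (S K'.aux)
      (segment (S K'.stack) ++ (segment l' ++ segment (S K'.rev)))
    obtain ⟨r₄, -, R₄⟩ := reach_done_done hN q' v' (k := K'.aux) rfl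
      (S K'.stack)
      (segment l' ++ (segment (S K'.rev) ++ segment (S K'.aux)))
    simp only [List.append_assoc] at R₁ R₂ R₃ R₄
    exact ⟨_, _, by omega, rfl, ((R₁.trans R₂).trans R₃).trans R₄⟩
  | rev =>
    obtain ⟨r₁, h₁, R₁⟩ := reach_todo hN hc (htodo K'.main (by simp)) (S K'.main)
      (segment (S K'.rev) ++ (segment (S K'.aux) ++ segment (S K'.stack)))
    obtain ⟨r₂, c₂, h₂, e₂, R₂⟩ := hop (todo K'.main q v) (segment (S K'.aux) ++
      (segment (S K'.stack) ++ segment (S K'.main))) rfl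
    obtain ⟨r₃, -, R₃⟩ := reach_done hN rfl e₂ (S K'.aux)
      (segment (S K'.stack) ++ (segment (S K'.main) ++ segment l'))
    obtain ⟨r₄, -, R₄⟩ := reach_done_done hN q' v' (k := K'.aux) rfl
      (S K'.stack)
      (segment (S K'.main) ++ (segment l' ++ segment (S K'.aux)))
    simp only [List.append_assoc] at R₁ R₂ R₃ R₄
    exact ⟨_, _, by omega, rfl, ((R₁.trans R₂).trans R₃).trans R₄⟩
  | aux =>
    obtain ⟨r₁, h₁, R₁⟩ := reach_todo hN hc (htodo K'.main (by simp)) (S K'.main)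
      (segment (S K'.rev) ++ (segment (S K'.aux) ++ segment (S K'.stack)))
    obtain ⟨r₂, h₂, R₂⟩ := reach_todo hN (c := todo K'.main q v) rfl (htodo K'.rev (by simp))
      (S K'.rev) (segment (S K'.aux) ++ (segment (S K'.stack) ++ segment (S K'.main)))
    obtain ⟨r₃, c₃, h₃, e₃, R₃⟩ := hop (todo K'.rev q v) (segment (S K'.stack) ++
      (segment (S K'.main) ++ segment (S K'.rev))) rfl
    obtain ⟨r₄, -, R₄⟩ := reach_done hN rfl e₃ (S K'.stack)
      (segment (S K'.main) ++ (segment (S K'.rev) ++ segment l'))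
    simp only [List.append_assoc] at R₁ R₂ R₃ R₄
    exact ⟨_, _, by omega, rfl, ((R₁.trans R₂).trans R₃).trans R₄⟩
  | stack =>
    obtain ⟨r₁, h₁, R₁⟩ := reach_todo hN hc (htodo K'.main (by simp)) (S K'.main)
      (segment (S K'.rev) ++ (segment (S K'.aux) ++ segment (S K'.stack)))
    obtain ⟨r₂, h₂, R₂⟩ := reach_todo hN (c := todo K'.main q v) rfl (htodo K'.rev (by simp))
      (S K'.rev) (segment (S K'.aux) ++ (segment (S K'.stack) ++ segment (S K'.main)))
    obtain ⟨r₃, h₃, R₃⟩ := reach_todo hN (c := todo K'.rev q v) rfl (htodo K'.aux (by simp))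
      (S K'.aux) (segment (S K'.stack) ++ (segment (S K'.main) ++ segment (S K'.rev)))
    obtain ⟨r₄, c₄, h₄, e₄, R₄⟩ := hop (todo K'.aux q v) (segment (S K'.main) ++
      (segment (S K'.rev) ++ segment (S K'.aux))) rfl
    simp only [List.append_assoc] at R₁ R₂ R₃ R₄
    exact ⟨_, _, by omega, e₄, ((R₁.trans R₂).trans R₃).trans R₄⟩

/-- A pass that reads the top of the stack `k`, and keeps it if `keep` holds. -/
theorem reach_look {q q' : Stmt Γ Λ σ} {v : σ} {k : K'} {f : σ → Option Γ → σ} (keep : Bool)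
    (henter : ∀ j, enter M j v q = some (if j = k then look j q v else todo j q v, [none]))
    (hnone : step M (look k q v) none = advance M k q' (f v none))
    (hsome : ∀ x, step M (look k q v) (some x) =
      some (done k q' (f v (some x)), if keep then [some x] else []))
    {S : K' → List Γ} {c : Control Γ Λ σ} (hc : step M c none = enter M K'.main v q) :
    ∃ r c₁, 1 ≤ r ∧ step M c₁ none = enter M K'.main (f v (S k).head?) q' ∧
      N.Reach r c (content S) c₁
        (content (Function.update S k (if keep then S k else (S k).tail))) := by
  refine reach_pass hN (q' := q') (fun j hj => by rw [henter, if_neg hj]) (fun c Q hc => ?_) hc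
  rw [henter, if_pos rfl] at hc
  cases hS : S k with
  | nil =>
    refine ⟨1, look k q v, le_rfl, by simpa using hnone, .step (by rw [hN, hc]) ?_⟩
    simpa [segment] using Reach.refl (look k q v) (Q ++ [none])
  | cons x l =>
    have h₁ (ys : List (Option Γ))
        (h : step M (look k q v) (some x) = some (done k q' (f v (some x)), ys)) :
        N.Reach (l.length + 1 + 1) c (segment (x :: l) ++ Q) (done k q' (f v (some x)))
          (Q ++ ([none] ++ (ys ++ l.map some))) := by
      refine .step (by rw [hN, hc]) (.step (by rw [hN, h]) ?_)
      have h' := reach_copy hN (c := done k q' (f v (some x))) (fun _ => rfl) l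
        (Q ++ ([none] ++ ys))
      simpa using h'
    refine ⟨l.length + 1 + 1, done k q' (f v (some x)), by omega, rfl, ?_⟩
    cases keep <;> simpa [segment] using h₁ _ (hsome x)

/-- A pass that does not change the stacks. -/
theorem reach_internal {q q' : Stmt Γ Λ σ} {v v' : σ}
    (h : ∀ j, enter M j v q = some (done j q' v', [none])) (S : K' → List Γ)
    {c : Control Γ Λ σ} (hc : step M c none = enter M K'.main v q) :
    ∃ r c₁, 1 ≤ r ∧ step M c₁ none = enter M K'.main v' q' ∧
      N.Reach r c (content S) c₁ (content S) := by
  rw [h] at hc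
  obtain ⟨r₁, h₁, R₁⟩ := reach_segment hN hc (fun _ => rfl) (S K'.main) (segment (S K'.rev) ++
    (segment (S K'.aux) ++ segment (S K'.stack)))
  obtain ⟨r₂, -, R₂⟩ := reach_done_done hN q' v' (k := K'.main) rfl (S K'.rev)
    (segment (S K'.aux) ++ (segment (S K'.stack) ++ segment (S K'.main)))
  obtain ⟨r₃, -, R₃⟩ := reach_done_done hN q' v' (k := K'.rev) rfl (S K'.aux)
    (segment (S K'.stack) ++ (segment (S K'.main) ++ segment (S K'.rev)))
  obtain ⟨r₄, -, R₄⟩ := reach_done_done hN q' v' (k := K'.aux) rfl (S K'.stack)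
    (segment (S K'.main) ++ (segment (S K'.rev) ++ segment (S K'.aux)))
  simp only [List.append_assoc] at R₁ R₂ R₃ R₄
  exact ⟨_, _, by omega, rfl, ((R₁.trans R₂).trans R₃).trans R₄⟩

end reach

/-- From the control state `c` with stacks `S`, the queue machine gets to the configuration `cfg` of
the machine with four stacks. -/
def Simulates (N : QueueMachine (Control Γ Λ σ) (Option Γ)) (M : Λ → Stmt Γ Λ σ)
    (c : Control Γ Λ σ) (S : K' → List Γ) : TM2.Cfg (fun _ : K' => Γ) Λ σ → Prop
  | ⟨some l, v, S'⟩ => ∃ r c', 1 ≤ r ∧ step M c' none = enter M K'.main v (M l) ∧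
      N.Reach r c (content S) c' (content S')
  | ⟨none, _, _⟩ => ∃ r c' x Q, N.Reach r c (content S) c' (x :: Q) ∧ step M c' x = none

variable {N : QueueMachine (Control Γ Λ σ) (Option Γ)} {M : Λ → Stmt Γ Λ σ}

theorem Simulates.of_reach {r : ℕ} {c c₁ : Control Γ Λ σ} {S S' : K' → List Γ}
    {cfg : TM2.Cfg (fun _ : K' => Γ) Λ σ} (R : N.Reach r c (content S) c₁ (content S'))
    (h : Simulates N M c₁ S' cfg) : Simulates N M c S cfg := by
  obtain ⟨_ | l, v, S''⟩ := cfg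
  · obtain ⟨r', c', x, Q, R', h'⟩ := h
    exact ⟨_, c', x, Q, R.trans R', h'⟩
  · obtain ⟨r', c', hr, h', R'⟩ := h
    exact ⟨_, c', by omega, h', R.trans R'⟩

/-- The simulation of a sequence of statements up to the next label. -/
theorem simulates_stepAux (hN : N.step = step M) (q : Stmt Γ Λ σ) (v : σ) (S : K' → List Γ)
    (c : Control Γ Λ σ) (hc : step M c none = enter M K'.main v q) :
    Simulates N M c S (TM2.stepAux q v S) := by
  induction q generalizing v S c with
  | push k f q ih =>
    obtain ⟨r, c₁, -, h₁, R⟩ := reach_pass hN (q := push k f q) (q' := q) (v := v) (v' := v)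
      (k := k) (S := S) (l' := f v :: S k) (fun j hj => by simp [enter, hj]) (fun c Q hc => by
        obtain ⟨r, hr, R⟩ := reach_segment hN (hc.trans (by simp only [enter, if_true]; rfl))
          (fun _ => rfl) (S k) Q
        exact ⟨r, _, hr, rfl, by simpa [segment] using R⟩) hc
    exact (ih _ _ c₁ h₁).of_reach R
  | peek k f q ih =>
    obtain ⟨r, c₁, -, h₁, R⟩ := reach_look hN (q := peek k f q) (q' := q) (k := k) (f := f) true
      (fun j => by simp only [enter]; split_ifs <;> rfl) rfl (fun _ => rfl) (S := S) hc
    rw [if_pos rfl, Function.update_eq_self] at R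
    exact (ih _ _ c₁ h₁).of_reach R
  | pop k f q ih =>
    obtain ⟨r, c₁, -, h₁, R⟩ := reach_look hN (q := pop k f q) (q' := q) (k := k) (f := f) false
      (fun j => by simp only [enter]; split_ifs <;> rfl) rfl (fun _ => rfl) (S := S) hc
    exact (ih _ _ c₁ h₁).of_reach R
  | load a q ih =>
    obtain ⟨r, c₁, -, h₁, R⟩ := reach_internal hN (fun _ => rfl) S hc
    exact (ih _ _ c₁ h₁).of_reach R
  | branch f q₁ q₂ ih₁ ih₂ =>
    obtain ⟨r, c₁, -, h₁, R⟩ := reach_internal hN (fun _ => rfl) S hc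
    refine Simulates.of_reach R ?_
    rw [TM2.stepAux]
    cases h : f v <;> rw [h] at h₁
    · exact ih₂ _ _ c₁ h₁
    · exact ih₁ _ _ c₁ h₁
  | goto l => exact reach_internal hN (fun _ => rfl) S hc
  | halt => exact ⟨0, c, none, _, .refl c _, hc⟩

theorem exists_reach_of_reaches (hN : N.step = step M) {a b : TM2.Cfg (fun _ : K' => Γ) Λ σ}
    (h : StateTransition.Reaches (TM2.step M) a b) (hb : TM2.step M b = none) {l : Λ} {v : σ}
    {S : K' → List Γ} (ha : a = ⟨some l, v, S⟩) {c : Control Γ Λ σ}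
    (hc : step M c none = enter M K'.main v (M l)) :
    ∃ r c' x Q, N.Reach r c (content S) c' (x :: Q) ∧ step M c' x = none := by
  induction h using Relation.ReflTransGen.head_induction_on generalizing l v S c with
  | refl => subst ha; simp at hb
  | @head a a' h _ ih =>
    subst ha
    have h' : TM2.stepAux (M l) v S = a' := by simpa using h
    have hs := simulates_stepAux hN (M l) v S c hc
    rw [h'] at hs
    obtain ⟨_ | l', v', S'⟩ := a'
    · exact hs
    · obtain ⟨r, c', -, h'', R⟩ := hs
      obtain ⟨r', c'', x, Q, R', hx⟩ := ih rfl h''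
      exact ⟨_, c'', x, Q, R.trans R', hx⟩

/-- Every step of the stack machine costs the queue machine at least one step. -/
theorem exists_reach_of_not_dom (hN : N.step = step M) (n : ℕ) {l : Λ} {v : σ} {S : K' → List Γ}
    (h : ¬ (StateTransition.eval (TM2.step M) ⟨some l, v, S⟩).Dom) {c : Control Γ Λ σ}
    (hc : step M c none = enter M K'.main v (M l)) :
    ∃ r c' Q, n ≤ r ∧ N.Reach r c (content S) c' Q := by
  induction n generalizing l v S c with
  | zero => exact ⟨0, c, _, le_rfl, .refl c _⟩
  | succ n ih =>
    have hs := simulates_stepAux hN (M l) v S c hc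
    rw [StateTransition.reaches_eval (f := TM2.step M) (a := ⟨some l, v, S⟩)
      (b := TM2.stepAux (M l) v S) (Relation.ReflTransGen.single rfl)] at h
    generalize TM2.stepAux (M l) v S = a at hs h
    obtain ⟨_ | l', v', S'⟩ := a
    · exact absurd (Part.dom_iff_mem.2 ⟨_, StateTransition.mem_eval.2 ⟨.refl, rfl⟩⟩) h
    · obtain ⟨r, c', hr, h', R⟩ := hs
      obtain ⟨r', c'', Q, hr', R'⟩ := ih h h'
      exact ⟨_, c'', Q, by omega, R.trans R'⟩

section machine

variable (M : Λ → Stmt Γ' Λ σ) (l₀ : Λ) (v₀ : σ)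

theorem reach_input (n : ℕ) : ∃ r c, step M c none = enter M K'.main v₀ (M l₀) ∧
    (machine M l₀ v₀).Reach r (machine M l₀ v₀).start ((machine M l₀ v₀).input n) c
      (content (PartrecToTM2.K'.elim (List.replicate n Γ'.bit0 ++ [Γ'.bit1, Γ'.cons]) [] [] [])) := by
  have hN : (machine M l₀ v₀).step = step M := rfl
  have R₁ := reach_copy hN (c := done K'.main (M l₀) v₀) (fun _ => rfl)
    (List.replicate n Γ'.bit0 ++ [Γ'.bit1, Γ'.cons]) [none, none, none, none]
  obtain ⟨r₂, -, R₂⟩ := reach_done_done hN (M l₀) v₀ (k := K'.main) rfl []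
    ([none, none, none] ++ (List.replicate n Γ'.bit0 ++ [Γ'.bit1, Γ'.cons]).map some)
  obtain ⟨r₃, -, R₃⟩ := reach_done_done hN (M l₀) v₀ (k := K'.rev) rfl []
    ([none, none] ++ ((List.replicate n Γ'.bit0 ++ [Γ'.bit1, Γ'.cons]).map some ++ segment []))
  obtain ⟨r₄, -, R₄⟩ := reach_done_done hN (M l₀) v₀ (k := K'.aux) rfl []
    ([none] ++ ((List.replicate n Γ'.bit0 ++ [Γ'.bit1, Γ'.cons]).map some ++
      (segment [] ++ segment [])))
  simp only [List.append_assoc] at R₁ R₂ R₃ R₄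
  have R := ((R₁.trans R₂).trans R₃).trans R₄
  -- The initial queue must start with the units, so it is a rotation of the proper content, with
  -- the separator of `main` at its end. Copying `main` and three separators rotates it into place.
  refine ⟨n + 2 + r₂ + r₃ + r₄, done K'.stack (M l₀) v₀, rfl, ?_⟩
  have e₁ : (machine M l₀ v₀).input n =
      (List.replicate n Γ'.bit0 ++ [Γ'.bit1, Γ'.cons]).map some ++ [none, none, none, none] := by
    simp [QueueMachine.input, machine]
  rw [e₁]
  change (machine M l₀ v₀).Reach _ (done K'.main (M l₀) v₀) _ _ _
  simpa [content, segment] using R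

theorem machine_halts {n : ℕ} (h : (StateTransition.eval (TM2.step M) ⟨some l₀, v₀,
    PartrecToTM2.K'.elim (List.replicate n Γ'.bit0 ++ [Γ'.bit1, Γ'.cons]) [] [] []⟩).Dom) :
    (machine M l₀ v₀).Halts n := by
  obtain ⟨r, c, hc, R⟩ := reach_input M l₀ v₀ n
  obtain ⟨b, hb⟩ := Part.dom_iff_mem.1 h
  obtain ⟨h₁, h₂⟩ := StateTransition.mem_eval.1 hb
  obtain ⟨r', c', x, Q, R', hx⟩ := exists_reach_of_reaches (N := machine M l₀ v₀) rfl h₁ h₂ rfl hc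
  exact ⟨_, c', x, Q, R.trans R', hx⟩

theorem machine_diverges {n : ℕ} (h : ¬ (StateTransition.eval (TM2.step M) ⟨some l₀, v₀,
    PartrecToTM2.K'.elim (List.replicate n Γ'.bit0 ++ [Γ'.bit1, Γ'.cons]) [] [] []⟩).Dom) :
    (machine M l₀ v₀).Diverges n := by
  obtain ⟨r, c, hc, R⟩ := reach_input M l₀ v₀ n
  intro m
  obtain ⟨r', c', Q, hm, R'⟩ := exists_reach_of_not_dom (N := machine M l₀ v₀) rfl m h hc
  exact ⟨_, c', Q, by omega, R.trans R'⟩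

end machine

/-! ### Finiteness of the reachable control states -/

/-- The statement stored in a control state. -/
def Control.stmt : Control Γ Λ σ → Stmt Γ Λ σ
  | todo _ q _ => q
  | look _ q _ => q
  | done _ q _ => q

theorem finite_control [Finite σ] (T : Finset (Option (Stmt Γ Λ σ))) :
    {c : Control Γ Λ σ | some c.stmt ∈ T}.Finite := by
  have : Finite K' := Finite.of_surjective
    (![K'.main, K'.rev, K'.aux, K'.stack] : Fin 4 → K') fun k => by
      cases k
      exacts [⟨0, rfl⟩, ⟨1, rfl⟩, ⟨2, rfl⟩, ⟨3, rfl⟩]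
  have hT : {q | some q ∈ T}.Finite :=
    T.finite_toSet.preimage (Option.some_injective _).injOn
  have := hT.to_subtype
  let F (p : K' × {q | some q ∈ T} × σ) : Set (Control Γ Λ σ) :=
    {todo p.1 p.2.1 p.2.2, look p.1 p.2.1 p.2.2, done p.1 p.2.1 p.2.2}
  refine (Set.finite_iUnion (f := F) fun p => by simp [F]).subset fun c hc => ?_
  rw [Set.mem_iUnion]
  cases c with
  | todo k q v => exact ⟨(k, ⟨q, hc⟩, v), by simp [F]⟩
  | look k q v => exact ⟨(k, ⟨q, hc⟩, v), by simp [F]⟩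
  | done k q v => exact ⟨(k, ⟨q, hc⟩, v), by simp [F]⟩

variable {S : Finset Λ}

/-- Executing a statement leads to one of its substatements or, by `goto`, to the statement of a
supported label; both lie in the finite set `TM2.stmts M S`. -/
theorem stmt_mem_of_enter (hS : ∀ l ∈ S, TM2.SupportsStmt S (M l)) {j : K'} {v : σ}
    {q : Stmt Γ Λ σ} (hq : some q ∈ TM2.stmts M S) {c : Control Γ Λ σ} {ys : List (Option Γ)}
    (h : enter M j v q = some (c, ys)) : some c.stmt ∈ TM2.stmts M S := by
  cases q with
  | push k f q =>
    simp only [enter] at h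
    split_ifs at h <;> obtain ⟨rfl, -⟩ := Prod.mk.inj (Option.some.inj h)
    · exact TM2.stmts_trans (by simp [TM2.stmts₁, TM2.stmts₁_self, stmt]) hq
    · exact hq
  | peek k f q =>
    simp only [enter] at h
    split_ifs at h <;> obtain ⟨rfl, -⟩ := Prod.mk.inj (Option.some.inj h) <;> exact hq
  | pop k f q =>
    simp only [enter] at h
    split_ifs at h <;> obtain ⟨rfl, -⟩ := Prod.mk.inj (Option.some.inj h) <;> exact hq
  | load a q =>
    obtain ⟨rfl, -⟩ := Prod.mk.inj (Option.some.inj h)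
    exact TM2.stmts_trans (by simp [TM2.stmts₁, TM2.stmts₁_self, stmt]) hq
  | branch f q₁ q₂ =>
    obtain ⟨rfl, -⟩ := Prod.mk.inj (Option.some.inj h)
    refine TM2.stmts_trans ?_ hq
    cases hf : f v <;> simp [TM2.stmts₁, TM2.stmts₁_self, stmt]
  | goto l =>
    obtain ⟨rfl, -⟩ := Prod.mk.inj (Option.some.inj h)
    simp only [TM2.stmts, Finset.mem_insertNone, Finset.mem_biUnion, Option.mem_def,
      Option.some.injEq, forall_eq'] at hq ⊢
    obtain ⟨l', hl', hq⟩ := hq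
    exact ⟨l v, TM2.stmts₁_supportsStmt_mono hq (hS l' hl') v, TM2.stmts₁_self⟩
  | halt => cases h

theorem stmt_mem_of_advance (hS : ∀ l ∈ S, TM2.SupportsStmt S (M l)) {k : K'} {v : σ}
    {q : Stmt Γ Λ σ} (hq : some q ∈ TM2.stmts M S) {c : Control Γ Λ σ} {ys : List (Option Γ)}
    (h : advance M k q v = some (c, ys)) : some c.stmt ∈ TM2.stmts M S := by
  cases k <;> first
    | exact stmt_mem_of_enter hS hq h
    | (obtain ⟨rfl, -⟩ := Prod.mk.inj (Option.some.inj h); exact hq)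

theorem stmt_mem_of_step (hS : ∀ l ∈ S, TM2.SupportsStmt S (M l)) {c c' : Control Γ Λ σ}
    (hc : some c.stmt ∈ TM2.stmts M S) {x : Option Γ} {ys : List (Option Γ)}
    (h : step M c x = some (c', ys)) : some c'.stmt ∈ TM2.stmts M S := by
  cases c with
  | todo k q v =>
    cases x with
    | some x => obtain ⟨rfl, -⟩ := Prod.mk.inj (Option.some.inj h); exact hc
    | none =>
      obtain ⟨k', -, h⟩ := Option.bind_eq_some_iff.1 h
      exact stmt_mem_of_enter hS hc h
  | done k q v =>
    cases x with
    | some x => obtain ⟨rfl, -⟩ := Prod.mk.inj (Option.some.inj h); exact hc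
    | none => exact stmt_mem_of_advance hS hc h
  | look k q v =>
    cases q with
    | peek k' f q =>
      have hq : some q ∈ TM2.stmts M S :=
        TM2.stmts_trans (q₂ := peek k' f q) (by simp [TM2.stmts₁, TM2.stmts₁_self]) hc
      cases x with
      | some x => obtain ⟨rfl, -⟩ := Prod.mk.inj (Option.some.inj h); exact hq
      | none => exact stmt_mem_of_advance hS hq h
    | pop k' f q =>
      have hq : some q ∈ TM2.stmts M S :=
        TM2.stmts_trans (q₂ := pop k' f q) (by simp [TM2.stmts₁, TM2.stmts₁_self]) hc
      cases x with
      | some x => obtain ⟨rfl, -⟩ := Prod.mk.inj (Option.some.inj h); exact hq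
      | none => exact stmt_mem_of_advance hS hq h
    | _ => cases x <;> cases h

end StackQueue

/-! ### Encoding the halting problem in the threshold -/

open Turing

/-- In binary, least significant bit first, a power of two is essentially unary; this matches the
unary input of the queue machine. -/
theorem trList_two_pow (n : ℕ) : PartrecToTM2.trList [2 ^ n] =
    List.replicate n PartrecToTM2.Γ'.bit0 ++ [PartrecToTM2.Γ'.bit1, PartrecToTM2.Γ'.cons] := by
  have h : ∃ p : PosNum, ((2 ^ n : ℕ) : Num) = Num.pos p ∧
      PartrecToTM2.trPosNum p = List.replicate n PartrecToTM2.Γ'.bit0 ++ [PartrecToTM2.Γ'.bit1] := by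
    induction n with
    | zero => exact ⟨1, by simp; rfl, rfl⟩
    | succ n ih =>
      obtain ⟨p, h₁, h₂⟩ := ih
      refine ⟨p.bit0, ?_, by rw [PartrecToTM2.trPosNum, h₂]; rfl⟩
      have := Num.ofNat'_bit false (2 ^ n)
      rw [Num.ofNat'_eq, Num.ofNat'_eq, h₁] at this
      rw [pow_succ', ← Nat.bit_false_apply, this]
      rfl
  obtain ⟨p, h₁, h₂⟩ := h
  simp [PartrecToTM2.trNat, h₁, PartrecToTM2.trNum, h₂]

theorem primrec₂_pow : Primrec₂ ((· ^ ·) : ℕ → ℕ → ℕ) :=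
  Primrec₂.unpaired'.1 Nat.Primrec.pow

/-- Some code halts on `2 ^ n` if and only if the program with number `n` halts on `0`. -/
theorem exists_code_dom_iff : ∃ c : ToPartrec.Code, ∀ n : ℕ,
    (c.eval [2 ^ n]).Dom ↔ ((Denumerable.ofNat Nat.Partrec.Code n).eval 0).Dom := by
  -- The search recovers n from its power of two.
  let g : ℕ →. ℕ := fun x => (Nat.rfind fun n => Part.some (decide (2 ^ n = x))).bind fun n =>
    (Denumerable.ofNat Nat.Partrec.Code n).eval 0
  have hg : Partrec g := by
    refine Partrec.bind (Partrec.rfind ?_) ?_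
    · have : PrimrecPred fun p : ℕ × ℕ => 2 ^ p.2 = p.1 :=
        Primrec.eq.comp (primrec₂_pow.comp (Primrec.const 2) Primrec.snd) Primrec.fst
      exact this.decide.to_comp.partrec.of_eq fun p => by simp
    · exact Nat.Partrec.Code.eval_part.comp
        ((Computable.ofNat _).comp Computable.snd) (Computable.const 0)
  obtain ⟨c, hc⟩ := ToPartrec.Code.exists_code (Nat.Partrec'.part_iff₁.2 hg)
  refine ⟨c, fun n => ?_⟩
  have h₁ : c.eval [2 ^ n] = pure <$> g (2 ^ n) := hc ⟨[2 ^ n], rfl⟩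
  have h₂ : (Nat.rfind fun m => Part.some (decide (2 ^ m = 2 ^ n))) = Part.some n := by
    refine Part.eq_some_iff.2 (Nat.mem_rfind.2 ⟨by simp, fun {m} hm => ?_⟩)
    simp [hm.ne]
  have h₃ : g (2 ^ n) = (Denumerable.ofNat Nat.Partrec.Code n).eval 0 := by
    simp only [g, h₂, Part.bind_some]
  rw [h₁, h₃]
  rfl

namespace QueueMachine

theorem threshold_eq (n : ℕ) :
    threshold n = ((13 * 4 ^ (n + 1) + 3 : ℕ) : ℤ) / ((24 * 4 ^ (n + 1) : ℕ) : ℤ) := by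
  rw [threshold]
  push_cast
  field_simp
  ring

theorem threshold_nonneg (n : ℕ) : 0 ≤ threshold n := by rw [threshold]; positivity

theorem threshold_le_one (n : ℕ) : threshold n ≤ 1 := by
  have : (1 : ℚ) / 4 ^ (n + 1) ≤ 1 :=
    div_le_one_of_le₀ (one_le_pow₀ (by norm_num)) (by positivity)
  rw [threshold]
  linarith

/-- The algorithm receives `lam` in lowest terms, so computing its code requires knowing that this
fraction is reduced. -/
theorem coprime_threshold (n : ℕ) : (13 * 4 ^ (n + 1) + 3).Coprime (24 * 4 ^ (n + 1)) := by
  have h₂ : (13 * 4 ^ (n + 1) + 3).Coprime 2 := by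
    rw [Nat.coprime_two_right, pow_succ]
    exact ⟨13 * 4 ^ n * 2 + 1, by ring⟩
  have h₃ : (13 * 4 ^ (n + 1) + 3).Coprime 3 := by
    rw [Nat.coprime_comm, Nat.Prime.coprime_iff_not_dvd Nat.prime_three]
    have := Nat.pow_mod 4 (n + 1) 3
    norm_num at this
    omega
  rw [show 24 * 4 ^ (n + 1) = 3 * 2 ^ (2 * n + 5) by
    rw [show 2 ^ (2 * n + 5) = (2 ^ 2) ^ n * 2 ^ 5 by rw [pow_add, pow_mul]]; norm_num; ring]
  exact h₃.mul_right (h₂.pow_right _)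

theorem encodeRat_threshold (n : ℕ) : ProbAutomaton.encodeRat (threshold n) =
    (((13 * 4 ^ (n + 1) + 3 : ℕ) : ℤ), 24 * 4 ^ (n + 1)) := by
  have h : (0 : ℤ) < ((24 * 4 ^ (n + 1) : ℕ) : ℤ) := by positivity
  have hc : Nat.Coprime (((13 * 4 ^ (n + 1) + 3 : ℕ) : ℤ)).natAbs
      (((24 * 4 ^ (n + 1) : ℕ) : ℤ)).natAbs := by
    simpa only [Int.natAbs_natCast] using coprime_threshold n
  rw [ProbAutomaton.encodeRat, threshold_eq]
  refine Prod.ext (Rat.num_div_eq_of_coprime h hc) ?_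
  have := Rat.den_div_eq_of_coprime h hc
  exact_mod_cast this

theorem primrec_natCast_int : Primrec (fun n : ℕ => (n : ℤ)) := by
  refine Primrec.encode_iff.1 ?_
  -- A nonnegative integer n has code 2n.
  exact (Primrec.nat_mul.comp (Primrec.const 2) Primrec.id).of_eq fun n => by
    rfl

theorem computable_encodeRat_threshold :
    Computable fun n => ProbAutomaton.encodeRat (threshold n) := by
  have h₄ : Primrec fun n : ℕ => 4 ^ (n + 1) := primrec₂_pow.comp (Primrec.const 4) Primrec.succ
  have h : Primrec fun n : ℕ => (((13 * 4 ^ (n + 1) + 3 : ℕ) : ℤ), 24 * 4 ^ (n + 1)) :=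
    (primrec_natCast_int.comp (Primrec.nat_add.comp (Primrec.nat_mul.comp (Primrec.const 13) h₄)
      (Primrec.const 3))).pair (Primrec.nat_mul.comp (Primrec.const 24) h₄)
  exact h.to_comp.of_eq fun n => (encodeRat_threshold n).symm

end QueueMachine

/-- There is an automaton whose isolation problem encodes the halting problem. -/
theorem exists_automaton_halting : ∃ (n k : ℕ) (𝒜 : ProbAutomaton (Fin n) (Fin k)),
    (𝒜.IsSimple ∧ 𝒜.HasOneProbTransition) ∧ ∀ i : ℕ,
      𝒜.HasWordsNear (QueueMachine.threshold i) ↔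
        ¬ ((Denumerable.ofNat Nat.Partrec.Code i).eval 0).Dom := by
  obtain ⟨c, hc⟩ := exists_code_dom_iff
  set l := PartrecToTM2.trNormal c PartrecToTM2.Cont'.halt with hl
  have hS := PartrecToTM2.tr_supports c PartrecToTM2.Cont'.halt
  set S := PartrecToTM2.codeSupp c PartrecToTM2.Cont'.halt
  have hl' : l ∈ S := hS.1
  obtain ⟨n, k, 𝒜, h₁, h₂, h⟩ := (StackQueue.machine PartrecToTM2.tr l none).exists_automaton
    (by simp [StackQueue.machine]) (StackQueue.finite_control (TM2.stmts PartrecToTM2.tr S))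
    (by
      simp only [Set.mem_ofPred_eq, TM2.stmts, Finset.mem_insertNone, Finset.mem_biUnion,
        Option.mem_def, Option.some.injEq, forall_eq']
      exact ⟨l, hl', TM2.stmts₁_self⟩)
    (fun _ hc _ _ _ => StackQueue.stmt_mem_of_step hS.2 hc)
  refine ⟨n, k, 𝒜, ⟨h₁, h₂⟩, fun i => ?_⟩
  have hdom : (StateTransition.eval (TM2.step PartrecToTM2.tr) ⟨some l, none,
      PartrecToTM2.K'.elim (List.replicate i PartrecToTM2.Γ'.bit0 ++
        [PartrecToTM2.Γ'.bit1, PartrecToTM2.Γ'.cons]) [] [] []⟩).Dom ↔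
      ((Denumerable.ofNat Nat.Partrec.Code i).eval 0).Dom := by
    rw [← hc, ← trList_two_pow]
    exact iff_of_eq (congrArg Part.Dom (PartrecToTM2.tr_eval c [2 ^ i]))
  rw [← hdom]
  exact ⟨fun hn hd => (h i).1 (StackQueue.machine_halts _ _ _ hd) hn,
    fun hd => (h i).2 (StackQueue.machine_diverges _ _ _ hd)⟩

theorem mainTheorem1 :
    ¬ ProbAutomaton.IsolationDecidable
        (fun 𝒜 => 𝒜.IsSimple ∧ 𝒜.HasOneProbTransition) := by
  rintro ⟨f, hf, H⟩
  obtain ⟨n, k, 𝒜, h𝒜, h⟩ := exists_automaton_halting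
  choose g hg hiff using fun i => H n k 𝒜 h𝒜 (QueueMachine.threshold i)
    (QueueMachine.threshold_nonneg i) (QueueMachine.threshold_le_one i)
  -- The automaton is constant; only the threshold depends on i.
  have hcomp : Computable g :=
    (hf.comp ((Computable.const 𝒜.encode).pair
      QueueMachine.computable_encodeRat_threshold)).of_eq fun i => Part.eq_some_iff.2 (hg i)
  refine ComputablePred.halting_problem 0 (ComputablePred.computable_iff.2
    ⟨fun c => !g (Encodable.encode c), Primrec.not.to_comp.comp (hcomp.comp Computable.encode), ?_⟩)
  funext c
  have := (hiff (Encodable.encode c)).trans (h _)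
  rw [Denumerable.ofNat_encode] at this
  simpa using (not_congr this).symm
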